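/- Let $K$ be a commutative ring. For a unital associative $K$-algebra $A$ let $C^n(A)=\operatorname{Hom}_K(A^{\otimes n},A)$ ($n\ge 0$) be the Hochschild cochains with differential $$(\partial f)(a_1,\dots,a_{n+1})=a_1f(a_2,\dots,a_{n+1})+\sum_{i=1}^n(-1)^i f(a_1,\dots,a_ia_{i+1},\dots,a_{n+1})+(-1)^{n+1}f(a_1,\dots,a_n)a_{n+1},$$ let $\operatorname{HH}^n(A)=H^n(C^\ast(A),\partial)$ and $\operatorname{HH}^\ast(A)=\bigoplus_{n\ge0}\operatorname{HH}^n(A)$. For $f\in C^m(A)$, $g\in C^n(A)$ put $$(f\smallsmile g)(a_1,\dots,a_{m+n})=f(a_1,\dots,a_m)\,g(a_{m+1},\dots,a_{m+n}),$$ $$f\bullet g=\sum_{i=1}^m(-1)^{(i-1)(n-1)}f(\,\cdot\,,\dots,\,\cdot\,,\underbrace{g(\,\cdot\,,\dots,\,\cdot\,)}_{\text{slot }i},\,\cdot\,,\dots,\,\cdot\,)\in C^{m+n-1}(A).$$ The strict Gerstenhaber structure of $\operatorname{HH}^\ast(A)$ consists of the graded $K$-algebra structure given by the cup product $\smallsmile$,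 the bracket $\{-,-\}\colon\operatorname{HH}^m(A)\times\operatorname{HH}^n(A)\to\operatorname{HH}^{m+n-1}(A)$ induced by $\{f,g\}=f\bullet g-(-1)^{(m-1)(n-1)}g\bullet f$, and the squaring map $sq\colon\operatorname{HH}^{2n}(A)\to\operatorname{HH}^{4n-1}(A)$ induced by $sq(f)=f\bullet f$. Let $R$ and $S$ be $K$-algebras which are projective as $K$-modules. Then there is an isomorphism $$\operatorname{HH}^\ast(R\times S)\cong\operatorname{HH}^\ast(R)\times\operatorname{HH}^\ast(S)$$ of strict Gerstenhaber algebras, that is, an isomorphism of graded $K$-algebras which commutes with the brackets and with the squaring maps; here the product on the right-hand side carries the componentwise grading and operations. More generally, for every finite family $(A_i)_{i\in I}$ of $K$-algebras which are projective as $K$-modules there is an isomorphism $\operatorname{HH}^\ast\bigl(\prod_{i\in I}A_i\bigr)\cong\prod_{i\in I}\operatorname{HH}^\ast(A_i)$ of strict Gerstenhaber algebras. -/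

import Mathlib

set_option linter.unusedSectionVars false

namespace Hochschild

noncomputable section

variable (K : Type*) (A : Type*) [CommRing K] [Ring A] [Algebra K A]

/-- Hochschild `n`-cochains `Cⁿ(A, A) = Hom_K(A^{⊗ n}, A)`, as `K`-multilinear maps. -/
abbrev Cochain (n : ℕ) : Type _ := MultilinearMap K (fun _ : Fin n => A) A

variable {K A}

/-- A finite tuple, prolonged by zero to a sequence. -/
def pad {N : ℕ} (a : Fin N → A) (j : ℕ) : A := if h : j < N then a ⟨j, h⟩ else 0

/-- The sequence `a₀, …, a_{i-1}, y, a_{i+n}, a_{i+n+1}, …`: the `n` entries of `a` that start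
at position `i` are replaced by the single entry `y`. -/
def splice (i n : ℕ) (y : A) (a : ℕ → A) (j : ℕ) : A :=
  if j < i then a j else if j = i then y else a (j + n - 1)

/-- A function of tuples that is `K`-linear in each slot, as a multilinear map. -/
def ofSlots {N : ℕ} (F : (Fin N → A) → A)
    (h : ∀ a p, ∃ L : A →ₗ[K] A, ∀ x, F (Function.update a p x) = L x) : Cochain K A N :=
  MultilinearMap.mk' F
    (fun a p x y => by obtain ⟨L, hL⟩ := h a p; simp [hL])
    (fun a p c x => by obtain ⟨L, hL⟩ := h a p; simp [hL])

/-- The cup product on cochains: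
`(f ⌣ g)(a₁, …, a_{m+n}) = f(a₁, …, a_m) g(a_{m+1}, …, a_{m+n})`. -/
def cup {m n : ℕ} (f : Cochain K A m) (g : Cochain K A n) : Cochain K A (m + n) :=
  ofSlots (fun a => f (fun k => a (Fin.castAdd n k)) * g (fun k => a (Fin.natAdd m k))) (by
    intro a p
    induction p using Fin.addCases with
    | left p =>
      refine ⟨(LinearMap.mulRight K (g fun k => a (Fin.natAdd m k))) ∘ₗ
        f.toLinearMap (fun k => a (Fin.castAdd n k)) p, fun x => ?_⟩
      have h1 : (fun k => Function.update a (Fin.castAdd n p) x (Fin.castAdd n k))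
          = Function.update (fun k => a (Fin.castAdd n k)) p x := by
        ext k; simp only [Function.update_apply, Fin.castAdd_inj]
      have h2 : (fun k => Function.update a (Fin.castAdd n p) x (Fin.natAdd m k))
          = fun k => a (Fin.natAdd m k) := by
        ext k; rw [Function.update_of_ne]; intro h; simp [Fin.ext_iff] at h; omega
      simp [h1, h2]
    | right p =>
      refine ⟨(LinearMap.mulLeft K (f fun k => a (Fin.castAdd n k))) ∘ₗ
        g.toLinearMap (fun k => a (Fin.natAdd m k)) p, fun x => ?_⟩
      have h1 : (fun k => Function.update a (Fin.natAdd m p) x (Fin.natAdd m k))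
          = Function.update (fun k => a (Fin.natAdd m k)) p x := by
        ext k; simp only [Function.update_apply, Fin.natAdd_inj]
      have h2 : (fun k => Function.update a (Fin.natAdd m p) x (Fin.castAdd n k))
          = fun k => a (Fin.castAdd n k) := by
        ext k; rw [Function.update_of_ne]; intro h; simp [Fin.ext_iff] at h; omega
      simp [h1, h2])

/-- Insertion of `g` into the slot `i` of `f` (slots are counted from `0`; every index that
occurs is `< m + n - 1`, so that the padding of `a` is never seen):
`(f ∘ᵢ g)(a₀, …, a_{m+n-2}) = f(a₀, …, a_{i-1}, g(a_i, …, a_{i+n-1}), a_{i+n}, …, a_{m+n-2})`. -/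
def insertAt {m n : ℕ} (f : Cochain K A m) (g : Cochain K A n) (i : Fin m) :
    Cochain K A (m + n - 1) :=
  ofSlots (fun a => f (fun j => splice i n (g fun k => pad a (k + i)) (pad a) j)) (by
    intro a p
    obtain ⟨i, hi⟩ := i
    obtain ⟨p, hp⟩ := p
    have hpad : ∀ x j, pad (Function.update a ⟨p, hp⟩ x) j = if j = p then x else pad a j := by
      intro x j
      unfold pad
      by_cases hj : j < m + n - 1
      · simp only [hj, dif_pos, Function.update_apply, Fin.mk.injEq]
      · rw [dif_neg hj, dif_neg hj, if_neg (by omega)]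
    simp only [hpad]
    rcases lt_or_ge p i with h1 | h1
    · refine ⟨f.toLinearMap (fun j => splice i n (g fun k => pad a (k + i)) (pad a) j)
        ⟨p, by omega⟩, fun x => ?_⟩
      rw [MultilinearMap.toLinearMap_apply]
      congr 1
      ext ⟨j, hj⟩
      have : (fun k : Fin n => if (k : ℕ) + i = p then x else pad a (k + i))
          = fun k : Fin n => pad a (k + i) := by
        ext k; rw [if_neg (by omega)]
      simp only [this, Function.update_apply, Fin.mk.injEq, splice, hpad]
      split_ifs <;> first | rfl | omega
    rcases lt_or_ge p (i + n) with h2 | h2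
    · refine ⟨f.toLinearMap (fun j => splice i n (g fun k => pad a (k + i)) (pad a) j)
        ⟨i, hi⟩ ∘ₗ g.toLinearMap (fun k => pad a (k + i)) ⟨p - i, by omega⟩, fun x => ?_⟩
      rw [LinearMap.comp_apply, MultilinearMap.toLinearMap_apply,
        MultilinearMap.toLinearMap_apply]
      congr 1
      ext ⟨j, hj⟩
      have : (fun k : Fin n => if (k : ℕ) + i = p then x else pad a (k + i))
          = Function.update (fun k : Fin n => pad a (k + i)) ⟨p - i, by omega⟩ x := by
        ext ⟨k, hk⟩
        simp only [Function.update_apply, Fin.mk.injEq]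
        split_ifs <;> first | rfl | omega
      simp only [this, Function.update_apply, Fin.mk.injEq, splice, hpad]
      split_ifs <;> first | rfl | omega
    · refine ⟨f.toLinearMap (fun j => splice i n (g fun k => pad a (k + i)) (pad a) j)
        ⟨p + 1 - n, by omega⟩, fun x => ?_⟩
      rw [MultilinearMap.toLinearMap_apply]
      congr 1
      ext ⟨j, hj⟩
      have : (fun k : Fin n => if (k : ℕ) + i = p then x else pad a (k + i))
          = fun k : Fin n => pad a (k + i) := by
        ext k; rw [if_neg (by omega)]
      simp only [this, Function.update_apply, Fin.mk.injEq, splice, hpad]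
      split_ifs <;> first | rfl | omega)

/-- The multiplication of `A` as a `2`-cochain. -/
def mulCochain : Cochain K A 2 :=
  ofSlots (fun a => a 0 * a 1) (by
    intro a p
    fin_cases p
    · exact ⟨LinearMap.mulRight K (a 1), fun x => by simp⟩
    · exact ⟨LinearMap.mulLeft K (a 0), fun x => by simp⟩)

/-- `(a₀, …, a_n) ↦ a₀ f(a₁, …, a_n)`. -/
def mulLeft {n : ℕ} (f : Cochain K A n) : Cochain K A (n + 1) :=
  ofSlots (fun a => a 0 * f (fun k => a k.succ)) (by
    intro a p
    induction p using Fin.cases with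
    | zero =>
      exact ⟨LinearMap.mulRight K (f fun k => a k.succ), fun x => by simp⟩
    | succ p =>
      refine ⟨LinearMap.mulLeft K (a 0) ∘ₗ f.toLinearMap (fun k => a k.succ) p, fun x => ?_⟩
      have h1 : (fun k : Fin n => Function.update a p.succ x k.succ)
          = Function.update (fun k => a k.succ) p x := by
        ext k; simp only [Function.update_apply, Fin.succ_inj]
      have h2 : Function.update a p.succ x 0 = a 0 :=
        Function.update_of_ne (Fin.succ_ne_zero p).symm _ _
      simp [h1, h2])

/-- `(a₀, …, a_n) ↦ f(a₀, …, a_{n-1}) a_n`. -/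
def mulRight {n : ℕ} (f : Cochain K A n) : Cochain K A (n + 1) :=
  ofSlots (fun a => f (fun k => a k.castSucc) * a (Fin.last n)) (by
    intro a p
    induction p using Fin.lastCases with
    | last =>
      refine ⟨LinearMap.mulLeft K (f fun k => a k.castSucc), fun x => ?_⟩
      have h1 : (fun k : Fin n => Function.update a (Fin.last n) x k.castSucc)
          = fun k => a k.castSucc := by
        ext k; exact Function.update_of_ne (Fin.castSucc_lt_last k).ne _ _
      simp
    | cast p =>
      refine ⟨LinearMap.mulRight K (a (Fin.last n)) ∘ₗ
        f.toLinearMap (fun k => a k.castSucc) p, fun x => ?_⟩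
      have h1 : (fun k : Fin n => Function.update a p.castSucc x k.castSucc)
          = Function.update (fun k => a k.castSucc) p x := by
        ext k; simp only [Function.update_apply, Fin.castSucc_inj]
      have h2 : Function.update a p.castSucc x (Fin.last n) = a (Fin.last n) :=
        Function.update_of_ne (Fin.castSucc_lt_last p).ne' _ _
      simp [h1, h2])

/-- `(a₀, …, a_n) ↦ f(a₀, …, a_{i-1}, a_i a_{i+1}, a_{i+2}, …, a_n)`. -/
def mulInner {n : ℕ} (f : Cochain K A n) (i : Fin n) : Cochain K A (n + 1) :=
  insertAt f mulCochain i

lemma ofSlots_apply {N : ℕ} (F : (Fin N → A) → A)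
    (h : ∀ a p, ∃ L : A →ₗ[K] A, ∀ x, F (Function.update a p x) = L x) (a : Fin N → A) :
    ofSlots F h a = F a := rfl

/-- The Hochschild differential `∂ⁿ : Cⁿ(A, A) → Cⁿ⁺¹(A, A)`. -/
def d (n : ℕ) : Cochain K A n →ₗ[K] Cochain K A (n + 1) where
  toFun f := mulLeft f + ∑ i : Fin n, (-1 : K) ^ ((i : ℕ) + 1) • mulInner f i
    + (-1 : K) ^ (n + 1) • mulRight f
  map_add' f g := by
    ext a
    simp only [add_apply, sum_apply, smul_apply,
      mulLeft, mulInner, mulRight, insertAt, ofSlots_apply, mul_add, add_mul, smul_add,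
      Finset.sum_add_distrib]
    abel
  map_smul' c f := by
    ext a
    simp only [add_apply, sum_apply, smul_apply,
      mulLeft, mulInner, mulRight, insertAt, ofSlots_apply, mul_smul_comm, smul_mul_assoc,
      smul_add, Finset.smul_sum, RingHom.id_apply, smul_comm c]

/-- `f • g = ∑ᵢ (-1)^{i(n-1)} f ∘ᵢ g`, where `n` is the degree of `g` and `i` is counted from `0`
(`n + 1` has the parity of `n - 1`). If `f` has degree `0`, this is `0`. -/
def preLie {m n : ℕ} (f : Cochain K A m) (g : Cochain K A n) : Cochain K A (m + n - 1) :=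
  ∑ i : Fin m, (-1 : K) ^ ((i : ℕ) * (n + 1)) • insertAt f g i

/-- Transport of cochains along an equality of degrees. -/
def castDeg {m n : ℕ} (h : m = n) : Cochain K A m ≃ₗ[K] Cochain K A n :=
  MultilinearMap.domDomCongrLinearEquiv K K A A (finCongr h)


/-! ### Cochains as functions of sequences -/

/-- The value of an `n`-cochain on the first `n` entries of a sequence. -/
def ev {n : ℕ} : Cochain K A n →ₗ[K] ((ℕ → A) → A) where
  toFun f a := f (fun k => a k)
  map_add' _ _ := rfl
  map_smul' _ _ := rfl

lemma ev_apply {n : ℕ} (f : Cochain K A n) (a : ℕ → A) : ev f a = f (fun k => a k) := rfl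

lemma ev_congr {n : ℕ} (f : Cochain K A n) {a b : ℕ → A} (h : ∀ k < n, a k = b k) :
    ev f a = ev f b := by
  rw [ev_apply, ev_apply]; congr 1; ext k; exact h k k.2

lemma ev_injective {n : ℕ} : Function.Injective (ev : Cochain K A n → (ℕ → A) → A) := by
  intro f g h
  ext a
  have := congrFun h (pad a)
  simpa [ev_apply, pad] using this

lemma ev_castDeg {m n : ℕ} (h : m = n) (f : Cochain K A m) : ev (castDeg h f) = ev f := by
  subst h; rfl

/-- The sequence without its first `i` entries. -/
def shift (i : ℕ) (a : ℕ → A) (j : ℕ) : A := a (j + i)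

/-- Insertion at position `i`, on functions of sequences; `n` is the degree of `ψ`. -/
def rc (φ : (ℕ → A) → A) (i n : ℕ) (ψ : (ℕ → A) → A) (a : ℕ → A) : A :=
  φ (splice i n (ψ (shift i a)) a)

lemma ev_insertAt {m n : ℕ} (f : Cochain K A m) (g : Cochain K A n) (i : Fin m) :
    ev (insertAt f g i) = rc (ev f) i n (ev g) := by
  ext a
  have hp : ∀ j < m + n - 1, pad (fun k : Fin (m + n - 1) => a k) j = a j := by
    intro j hj; simp [pad, hj]
  rw [ev_apply, insertAt, ofSlots_apply, rc, ev_apply]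
  congr 1
  ext j
  have : (fun k : Fin n => pad (fun k : Fin (m + n - 1) => a k) (k + i))
      = fun k : Fin n => shift i a k := by
    ext k; rw [hp _ (by omega), shift]
  rw [this, ← ev_apply]
  unfold splice
  split_ifs
  · exact hp _ (by omega)
  · rfl
  · exact hp _ (by omega)

lemma ev_cup {m n : ℕ} (f : Cochain K A m) (g : Cochain K A n) (a : ℕ → A) :
    ev (cup f g) a = ev f a * ev g (shift m a) := by
  simp [ev_apply, cup, ofSlots_apply, shift, add_comm]

/-- Multiplication of the first two entries. -/
def mu (a : ℕ → A) : A := a 0 * a 1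

/-- `a₀ φ(a₁, …)`. -/
def rl (φ : (ℕ → A) → A) (a : ℕ → A) : A := a 0 * φ (shift 1 a)

/-- `φ(a) a_m`. -/
def rr (m : ℕ) (φ : (ℕ → A) → A) (a : ℕ → A) : A := φ a * a m

lemma ev_mulCochain : ev (mulCochain : Cochain K A 2) = mu := rfl

lemma ev_mulLeft {n : ℕ} (f : Cochain K A n) : ev (mulLeft f) = rl (ev f) := rfl

lemma ev_mulRight {n : ℕ} (f : Cochain K A n) : ev (mulRight f) = rr n (ev f) := rfl

lemma ev_mulInner {n : ℕ} (f : Cochain K A n) (i : Fin n) :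
    ev (mulInner f i) = rc (ev f) i 2 mu := ev_insertAt f mulCochain i

lemma ev_d {n : ℕ} (f : Cochain K A n) : ev (d n f) = rl (ev f)
    + ∑ i ∈ Finset.range n, (-1 : K) ^ (i + 1) • rc (ev f) i 2 mu
    + (-1 : K) ^ (n + 1) • rr n (ev f) := by
  simp only [d, LinearMap.coe_mk, AddHom.coe_mk, map_add, map_sum, map_smul, ev_mulLeft,
    ev_mulRight, ev_mulInner]
  rw [Finset.sum_range (fun i => (-1 : K) ^ (i + 1) • rc (ev f) i 2 mu)]

lemma ev_preLie {m n : ℕ} (f : Cochain K A m) (g : Cochain K A n) : ev (preLie f g)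
    = ∑ i ∈ Finset.range m, (-1 : K) ^ (i * (n + 1)) • rc (ev f) i n (ev g) := by
  simp only [preLie, map_sum, map_smul, ev_insertAt]
  rw [Finset.sum_range (fun i => (-1 : K) ^ (i * (n + 1)) • rc (ev f) i n (ev g))]

lemma rc_seq (φ ψ χ : (ℕ → A) → A) (i j n p : ℕ) (h : j < n) :
    rc (rc φ i n ψ) (i + j) p χ = rc φ i (n + p - 1) (rc ψ j p χ) := by
  ext a
  unfold rc
  have h1 : shift (i + j) a = shift j (shift i a) := by
    ext k; simp only [shift]; congr 1; omega
  have h2 : ∀ y, shift i (splice (i + j) p y a) = splice j p y (shift i a) := by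
    intro y; ext k; simp only [shift, splice]
    split_ifs <;> first | omega | rfl | (congr 1; omega)
  rw [h2, h1]
  congr 1
  ext k
  simp only [splice]
  split_ifs <;> first | omega | rfl | (congr 1; omega)

lemma rc_par (φ χ : (ℕ → A) → A) {n : ℕ} (g : Cochain K A n) (i j p : ℕ) (h : i < j) :
    rc (rc φ j p χ) i n (ev g) = rc (rc φ i n (ev g)) (j + n - 1) p χ := by
  ext a
  unfold rc
  have h1 : ∀ y, shift j (splice i n y a) = shift (j + n - 1) a := by
    intro y; ext k; simp only [shift, splice]
    split_ifs <;> first | omega | rfl | (congr 1; omega)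
  have h2 : ∀ z, ev g (shift i (splice (j + n - 1) p z a)) = ev g (shift i a) := by
    intro z
    apply ev_congr
    intro k hk
    simp only [shift, splice]
    split_ifs <;> first | omega | rfl
  rw [h1, h2]
  congr 1
  ext k
  simp only [splice]
  split_ifs <;> first | omega | rfl | (congr 1; omega)

lemma rl_rc (φ ψ : (ℕ → A) → A) (i n : ℕ) : rl (rc φ i n ψ) = rc (rl φ) (i + 1) n ψ := by
  ext a
  unfold rc rl
  have h1 : shift i (shift 1 a) = shift (i + 1) a := by
    ext k; simp only [shift]; congr 1
  have h2 : ∀ y, shift 1 (splice (i + 1) n y a) = splice i n y (shift 1 a) := by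
    intro y; ext k; simp only [shift, splice]
    split_ifs <;> first | omega | rfl | (congr 1; omega)
  have h3 : ∀ y, splice (i + 1) n y a 0 = a 0 := by intro y; simp [splice]
  simp only [h1, h2, h3]

lemma rc_rl_zero (φ ψ : (ℕ → A) → A) (n : ℕ) (a : ℕ → A) :
    rc (rl φ) 0 n ψ a = ψ a * φ (shift n a) := by
  unfold rc rl
  have h2 : ∀ y, shift 1 (splice 0 n y a) = shift n a := by
    intro y; ext k; simp only [shift, splice]
    rw [if_neg (by omega), if_neg (by omega)]; congr 1; omega
  rw [h2]
  rfl

lemma rr_rc (φ ψ : (ℕ → A) → A) (m i n : ℕ) (h : i < m) :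
    rr (m + n - 1) (rc φ i n ψ) = rc (rr m φ) i n ψ := by
  ext a
  unfold rc rr
  have h3 : ∀ y, splice i n y a m = a (m + n - 1) := by
    intro y; simp only [splice]; split_ifs <;> first | omega | rfl
  rw [h3]

lemma rc_rr_last {m : ℕ} (f : Cochain K A m) (ψ : (ℕ → A) → A) (n : ℕ) (a : ℕ → A) :
    rc (rr m (ev f)) m n ψ a = ev f a * ψ (shift m a) := by
  unfold rc rr
  have h1 : ∀ y, ev f (splice m n y a) = ev f a := by
    intro y; apply ev_congr; intro k hk; simp [splice, hk]
  rw [h1]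
  simp [splice]

lemma rc_mu_one (ψ : (ℕ → A) → A) (n : ℕ) : rc mu 1 n ψ = rl ψ := by
  ext a; simp [rc, mu, rl, splice]

lemma rc_mu_zero (ψ : (ℕ → A) → A) (n : ℕ) : rc mu 0 n ψ = rr n ψ := by
  ext a
  have : 1 + n - 1 = n := by omega
  have h : shift 0 a = a := rfl
  simp [rc, mu, rr, splice, this, h]

lemma rc_rl (φ ψ : (ℕ → A) → A) (i n : ℕ) :
    rc φ i (n + 1) (rl ψ) = rc (rc φ i 2 mu) (i + 1) n ψ := by
  rw [rc_seq _ _ _ _ _ _ _ (by omega), rc_mu_one]; congr 1; omega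

lemma rc_rr (φ ψ : (ℕ → A) → A) (i n : ℕ) :
    rc φ i (n + 1) (rr n ψ) = rc (rc φ i 2 mu) i n ψ := by
  have := rc_seq φ mu ψ i 0 2 n (by omega)
  rw [add_zero] at this
  rw [this, rc_mu_zero]; congr 1; omega

/-- Insertion is linear in the outer function. -/
def rcL (i n : ℕ) (ψ : (ℕ → A) → A) : ((ℕ → A) → A) →ₗ[K] ((ℕ → A) → A) where
  toFun φ := rc φ i n ψ
  map_add' _ _ := rfl
  map_smul' _ _ := rfl

lemma rcL_apply (i n : ℕ) (φ ψ : (ℕ → A) → A) : rc φ i n ψ = rcL (K := K) i n ψ φ := rfl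

lemma splice_update {m : ℕ} (i : ℕ) (hi : i < m) (n : ℕ) (y : A) (a : ℕ → A) :
    (fun k : Fin m => splice i n y a k)
      = Function.update (fun k : Fin m => splice i n 0 a k) ⟨i, hi⟩ y := by
  ext k
  simp only [Function.update_apply, splice, Fin.ext_iff]
  split_ifs <;> first | rfl | omega

/-- Insertion into a cochain is linear in the inner function. -/
def rcR {m : ℕ} (f : Cochain K A m) (i : ℕ) (hi : i < m) (n : ℕ) :
    ((ℕ → A) → A) →ₗ[K] ((ℕ → A) → A) where
  toFun ψ := rc (ev f) i n ψ
  map_add' ψ χ := by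
    ext a
    simp only [rc, ev_apply, Pi.add_apply]
    rw [splice_update i hi n (ψ _ + χ _), splice_update i hi n (ψ _), splice_update i hi n (χ _),
      MultilinearMap.map_update_add]
  map_smul' c ψ := by
    ext a
    simp only [rc, ev_apply, Pi.smul_apply, RingHom.id_apply]
    rw [splice_update i hi n (c • ψ _), splice_update i hi n (ψ _),
      MultilinearMap.map_update_smul]

/-- Left multiplication is linear. -/
def rlL : ((ℕ → A) → A) →ₗ[K] ((ℕ → A) → A) where
  toFun φ := rl φ
  map_add' _ _ := by ext a; simp [rl, mul_add]
  map_smul' _ _ := by ext a; simp [rl]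

/-- Right multiplication is linear. -/
def rrL (m : ℕ) : ((ℕ → A) → A) →ₗ[K] ((ℕ → A) → A) where
  toFun φ := rr m φ
  map_add' _ _ := by ext a; simp [rr, add_mul]
  map_smul' _ _ := by ext a; simp [rr]

lemma sum_split {M : Type*} [AddCommGroup M] (F : ℕ → M) (i m n : ℕ) (h : i < m) :
    ∑ j ∈ Finset.range (m + n - 1), F j
      = ∑ j ∈ Finset.range m, (if j < i then F j else 0) + ∑ j ∈ Finset.range n, F (i + j)
        + ∑ p ∈ Finset.range m, (if i < p then F (p + n - 1) else 0) := by
  obtain ⟨r, rfl⟩ : ∃ r, m = i + (1 + r) := ⟨m - i - 1, by omega⟩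
  have : i + (1 + r) + n - 1 = i + (n + r) := by omega
  rw [this, Finset.sum_range_add, Finset.sum_range_add _ n r, Finset.sum_range_add _ i (1 + r),
    Finset.sum_range_add _ i (1 + r), Finset.sum_range_add _ 1 r, Finset.sum_range_add _ 1 r]
  have h1 : ∑ x ∈ Finset.range i, (if x < i then F x else 0) = ∑ x ∈ Finset.range i, F x :=
    Finset.sum_congr rfl fun x hx => if_pos (Finset.mem_range.1 hx)
  have h2 : ∑ x ∈ Finset.range i, (if i < x then F (x + n - 1) else 0) = 0 :=
    Finset.sum_eq_zero fun x hx => if_neg (by have := Finset.mem_range.1 hx; omega)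
  have h3 : ∑ x ∈ Finset.range r, (if i < i + (1 + x) then F (i + (1 + x) + n - 1) else 0)
      = ∑ x ∈ Finset.range r, F (i + (n + x)) :=
    Finset.sum_congr rfl fun x _ => by rw [if_pos (by omega)]; congr 1; omega
  rw [h1, h2, h3]
  simp [add_assoc]


lemma sign_sq (k : ℕ) : (-1 : K) ^ k * (-1 : K) ^ k = 1 := by
  rw [← mul_pow]; simp

/-- The Leibniz rule `∂(f ⌣ g) = ∂f ⌣ g + (-1)ᵐ f ⌣ ∂g`. -/
lemma ev_d_cup {m n : ℕ} (f : Cochain K A m) (g : Cochain K A n) :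
    ev (d (m + n) (cup f g)) = ev (cup (d m f) g) + (-1 : K) ^ m • ev (cup f (d n g)) := by
  ext a
  have hsh : ∀ i j, shift i (shift j a) = shift (i + j) a := by
    intro i j; ext k; simp only [shift]; congr 1; omega
  have h1 : ∀ i ∈ Finset.range m, (-1 : K) ^ (i + 1) • rc (ev (cup f g)) i 2 mu a
      = (-1 : K) ^ (i + 1) • rc (ev f) i 2 mu a * ev g (shift (m + 1) a) := by
    intro i hi
    have hi := Finset.mem_range.1 hi
    have h : ∀ y, shift m (splice i 2 y a) = shift (m + 1) a := by
      intro y; ext k; simp only [shift, splice]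
      rw [if_neg (by omega), if_neg (by omega)]; congr 1
    simp only [rc, ev_cup, h, smul_mul_assoc]
  have h2 : ∀ j ∈ Finset.range n, (-1 : K) ^ (m + j + 1) • rc (ev (cup f g)) (m + j) 2 mu a
      = (-1 : K) ^ m • (ev f a * ((-1 : K) ^ (j + 1) • rc (ev g) j 2 mu (shift m a))) := by
    intro j hj
    have h : ∀ y, shift m (splice (m + j) 2 y a) = splice j 2 y (shift m a) := by
      intro y; ext k; simp only [shift, splice]
      split_ifs <;> first | omega | rfl | (congr 1; omega)
    have h' : ∀ y, ev f (splice (m + j) 2 y a) = ev f a := by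
      intro y; apply ev_congr; intro k hk; simp only [splice]; rw [if_pos (by omega)]
    simp only [rc, ev_cup, h, h', hsh, mul_smul_comm, smul_smul, ← pow_add,
      add_assoc, add_comm j m]
  simp only [ev_d, Pi.add_apply, Pi.smul_apply, Finset.sum_apply, ev_cup, Finset.sum_range_add]
  rw [Finset.sum_congr rfl h1, Finset.sum_congr rfl h2]
  simp only [rl, rr, ev_cup, add_mul, mul_add, Finset.sum_mul, Finset.mul_sum,
    smul_add, Finset.smul_sum, hsh, mul_assoc, smul_mul_assoc, mul_smul_comm, smul_smul,
    ← pow_add]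
  have e1 : shift m a 0 = a m := by simp [shift]
  have e2 : shift m a n = a (m + n) := by simp [shift, add_comm]
  have e3 : (-1 : K) ^ (m + 1) = - (-1 : K) ^ m := by ring
  rw [e1, e2, e3, add_comm 1 m]
  simp only [← add_assoc]
  module

/-- `∂(f • g) + (-1)ⁿ ∂f • g = f • ∂g + (-1)ⁿ (g ⌣ f - (-1)^{mn} f ⌣ g)`, evaluated. -/
lemma ev_d_preLie {m n : ℕ} (f : Cochain K A m) (g : Cochain K A n) :
    ev (d (m + n - 1) (preLie f g)) + (-1 : K) ^ n • ev (preLie (d m f) g)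
      = ev (preLie f (d n g))
        + (-1 : K) ^ n • (ev (cup g f) - (-1 : K) ^ (m * n) • ev (cup f g)) := by
  set φ := ev f with hφ
  set ψ := ev g with hψ
  let P : ℕ → (ℕ → A) → A := fun k => rc (rl φ) k n ψ
  let Q : ℕ → (ℕ → A) → A := fun k => rc (rr m φ) k n ψ
  let X : ℕ → ℕ → (ℕ → A) → A := fun i j => rc (rc φ i n ψ) j 2 mu
  let Y : ℕ → ℕ → (ℕ → A) → A := fun i k => rc (rc φ i 2 mu) k n ψ
  have hP0 : P 0 = ev (cup g f) := by
    ext a; simp only [P, rc_rl_zero, ev_cup]; rfl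
  have hQm : Q m = ev (cup f g) := by
    ext a; simp only [Q, hφ, rc_rr_last, ev_cup]; rfl
  have hX1 : ∀ i j, j < i → X i j = Y j (i + 1) := fun i j h => by
    exact rc_par φ ψ (mulCochain : Cochain K A 2) j i n h
  have hX2 : ∀ i p, i < p → X i (p + n - 1) = Y p i := fun i p h => by
    exact (rc_par φ mu g i p 2 h).symm
  -- the three parts
  have hA : ev (d (m + n - 1) (preLie f g))
      = ∑ i ∈ Finset.range m, (-1 : K) ^ (i * (n + 1)) • (P (i + 1)
        + ∑ j ∈ Finset.range (m + n - 1), (-1 : K) ^ (j + 1) • X i j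
        + (-1 : K) ^ (m + n) • Q i) := by
    have e : ∀ i ∈ Finset.range m, (-1 : K) ^ (m + n - 1 + 1) • rr (m + n - 1) (rc φ i n ψ)
        = (-1 : K) ^ (m + n) • Q i := by
      intro i hi
      have hi := Finset.mem_range.1 hi
      rw [rr_rc _ _ _ _ _ hi, Nat.sub_add_cancel (by omega)]
    have h1 : rl (ev (preLie f g))
        = ∑ i ∈ Finset.range m, (-1 : K) ^ (i * (n + 1)) • P (i + 1) := by
      rw [ev_preLie]
      change rlL (K := K) _ = _
      simp only [map_sum, map_smul]
      exact Finset.sum_congr rfl fun i _ =>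
        congrArg (fun t => (-1 : K) ^ (i * (n + 1)) • t) (rl_rc φ ψ i n)
    have h2 : (-1 : K) ^ (m + n - 1 + 1) • rr (m + n - 1) (ev (preLie f g))
        = ∑ i ∈ Finset.range m, (-1 : K) ^ (i * (n + 1)) • ((-1 : K) ^ (m + n) • Q i) := by
      rw [ev_preLie]
      change _ • rrL (K := K) (m + n - 1) _ = _
      simp only [map_sum, map_smul, Finset.smul_sum]
      refine Finset.sum_congr rfl fun i hi => ?_
      rw [← e i hi, smul_comm]; rfl
    have h3 : ∑ j ∈ Finset.range (m + n - 1), (-1 : K) ^ (j + 1) • rc (ev (preLie f g)) j 2 mu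
        = ∑ i ∈ Finset.range m, (-1 : K) ^ (i * (n + 1)) •
          ∑ j ∈ Finset.range (m + n - 1), (-1 : K) ^ (j + 1) • X i j := by
      simp only [Finset.smul_sum]
      rw [Finset.sum_comm]
      refine Finset.sum_congr rfl fun j _ => ?_
      rw [ev_preLie]
      rw [rcL_apply (K := K)]
      simp only [map_sum, map_smul, Finset.smul_sum]
      refine Finset.sum_congr rfl fun i _ => ?_
      rw [smul_comm]; rfl
    rw [ev_d, h1, h2, h3]
    simp only [smul_add, Finset.sum_add_distrib]
  have hB : ev (preLie (d m f) g)
      = ∑ k ∈ Finset.range (m + 1), (-1 : K) ^ (k * (n + 1)) • P k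
        + ∑ i ∈ Finset.range m, (-1 : K) ^ (i + 1) •
            ∑ k ∈ Finset.range (m + 2 - 1), (-1 : K) ^ (k * (n + 1)) • Y i k
        + (-1 : K) ^ (m + 1) •
            ∑ k ∈ Finset.range (m + 1), (-1 : K) ^ (k * (n + 1)) • Q k := by
    have e : ∀ k, rc (ev (d m f)) k n ψ = P k
        + ∑ i ∈ Finset.range m, (-1 : K) ^ (i + 1) • Y i k + (-1 : K) ^ (m + 1) • Q k := by
      intro k
      rw [ev_d]
      rw [rcL_apply (K := K)]
      simp only [map_add, map_sum, map_smul]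
      rfl
    rw [ev_preLie]
    simp only [← hψ, e, smul_add, Finset.sum_add_distrib, Finset.smul_sum]
    congr 1
    · congr 1
      rw [Finset.sum_comm]
      exact Finset.sum_congr rfl fun i _ => Finset.sum_congr rfl fun k _ => smul_comm _ _ _
    · exact Finset.sum_congr rfl fun k _ => smul_comm _ _ _
  have hC : ev (preLie f (d n g))
      = ∑ i ∈ Finset.range m, (-1 : K) ^ (i * n) • (Y i (i + 1)
        + ∑ j ∈ Finset.range n, (-1 : K) ^ (j + 1) • X i (i + j)
        + (-1 : K) ^ (n + 1) • Y i i) := by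
    rw [ev_preLie]
    refine Finset.sum_congr rfl fun i hi => ?_
    have hi := Finset.mem_range.1 hi
    have es : (-1 : K) ^ (i * (n + 1 + 1)) = (-1 : K) ^ (i * n) := by
      rw [show i * (n + 1 + 1) = i * n + 2 * i by ring, pow_add, pow_mul]; simp
    rw [es]
    congr 1
    rw [ev_d]
    change rcR f i hi (n + 1) _ = _
    simp only [map_add, map_sum, map_smul]
    change rc φ i (n + 1) (rl ψ) + (∑ j ∈ Finset.range n,
      (-1 : K) ^ (j + 1) • rc φ i (n + 1) (rc ψ j 2 mu))
      + (-1 : K) ^ (n + 1) • rc φ i (n + 1) (rr n ψ) = _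
    rw [rc_rl, rc_rr]
    congr 2
    refine Finset.sum_congr rfl fun j hj => ?_
    congr 1
    exact (rc_seq φ ψ mu i j n 2 (Finset.mem_range.1 hj)).symm
  -- splitting the double sums
  have hXs : ∀ i ∈ Finset.range m, ∑ j ∈ Finset.range (m + n - 1), (-1 : K) ^ (j + 1) • X i j
      = ∑ j ∈ Finset.range m, (if j < i then (-1 : K) ^ (j + 1) • Y j (i + 1) else 0)
        + ∑ j ∈ Finset.range n, (-1 : K) ^ (i + j + 1) • X i (i + j)
        + ∑ p ∈ Finset.range m, (if i < p then (-1 : K) ^ (p + n) • Y p i else 0) := by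
    intro i hi
    rw [sum_split _ i m n (Finset.mem_range.1 hi)]
    congr 1
    · congr 1
      refine Finset.sum_congr rfl fun j _ => ?_
      split_ifs with h
      · rw [hX1 _ _ h]
      · rfl
    · refine Finset.sum_congr rfl fun p _ => ?_
      split_ifs with h
      · rw [hX2 _ _ h]; congr 2; omega
      · rfl
  have hYs : ∀ i ∈ Finset.range m,
      ∑ k ∈ Finset.range (m + 2 - 1), (-1 : K) ^ (k * (n + 1)) • Y i k
      = ∑ j ∈ Finset.range m, (if j < i then (-1 : K) ^ (j * (n + 1)) • Y i j else 0)
        + ((-1 : K) ^ (i * (n + 1)) • Y i i + (-1 : K) ^ ((i + 1) * (n + 1)) • Y i (i + 1))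
        + ∑ p ∈ Finset.range m,
            (if i < p then (-1 : K) ^ ((p + 1) * (n + 1)) • Y i (p + 1) else 0) := by
    intro i hi
    rw [sum_split _ i m 2 (Finset.mem_range.1 hi)]
    congr 1
    congr 1
    simp [Finset.sum_range_succ]
  have hsgn : ∀ k : ℕ, (-1 : K) ^ k * (-1 : K) ^ k = 1 := sign_sq
  -- the parts of the sums
  have hA' : ev (d (m + n - 1) (preLie f g))
      = ∑ i ∈ Finset.range m, (-1 : K) ^ (i * (n + 1)) • P (i + 1)
        + ∑ i ∈ Finset.range m, ∑ j ∈ Finset.range m,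
            (if j < i then (-1 : K) ^ (i * (n + 1) + j + 1) • Y j (i + 1) else 0)
        + ∑ i ∈ Finset.range m, (-1 : K) ^ (i * n) •
            ∑ j ∈ Finset.range n, (-1 : K) ^ (j + 1) • X i (i + j)
        + ∑ i ∈ Finset.range m, ∑ p ∈ Finset.range m,
            (if i < p then (-1 : K) ^ (i * (n + 1) + p + n) • Y p i else 0)
        + (-1 : K) ^ (m + n) • ∑ i ∈ Finset.range m, (-1 : K) ^ (i * (n + 1)) • Q i := by
    rw [hA]
    simp only [Finset.smul_sum, ← Finset.sum_add_distrib]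
    refine Finset.sum_congr rfl fun i hi => ?_
    rw [hXs i hi]
    simp only [smul_add, Finset.smul_sum, smul_ite, smul_zero, smul_smul, ← pow_add]
    have e1 : ∀ j, (-1 : K) ^ (i * (n + 1) + (i + j + 1)) = (-1 : K) ^ (i * n + (j + 1)) := by
      intro j
      rw [show i * (n + 1) + (i + j + 1) = i * n + (j + 1) + 2 * i by ring, pow_add _ _ (2 * i),
        pow_mul]; simp
    simp only [e1]
    simp only [← add_assoc, add_comm (i * (n + 1)) (m + n)]
  have hB' : (-1 : K) ^ n • ev (preLie (d m f) g)
      = (-1 : K) ^ n • P 0 - ∑ i ∈ Finset.range m, (-1 : K) ^ (i * (n + 1)) • P (i + 1)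
        - ∑ i ∈ Finset.range m, ∑ j ∈ Finset.range m,
            (if j < i then (-1 : K) ^ (j * (n + 1) + i + n) • Y i j else 0)
        + ∑ i ∈ Finset.range m, (-1 : K) ^ (i * n) • (-1 : K) ^ (n + 1) • Y i i
        + ∑ i ∈ Finset.range m, (-1 : K) ^ (i * n) • Y i (i + 1)
        - ∑ i ∈ Finset.range m, ∑ p ∈ Finset.range m,
            (if i < p then (-1 : K) ^ (p * (n + 1) + i + 1) • Y i (p + 1) else 0)
        - (-1 : K) ^ (m + n) • ∑ i ∈ Finset.range m, (-1 : K) ^ (i * (n + 1)) • Q i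
        - ((-1 : K) ^ n * (-1 : K) ^ (m * n)) • Q m := by
    have t1 : (-1 : K) ^ n • ∑ k ∈ Finset.range (m + 1), (-1 : K) ^ (k * (n + 1)) • P k
        = (-1 : K) ^ n • P 0 - ∑ i ∈ Finset.range m, (-1 : K) ^ (i * (n + 1)) • P (i + 1) := by
      rw [Finset.sum_range_succ', smul_add, Finset.smul_sum, add_comm, sub_eq_add_neg,
        ← Finset.sum_neg_distrib]
      congr 1
      · simp
      · refine Finset.sum_congr rfl fun i _ => ?_
        rw [smul_smul, ← neg_smul]
        congr 1
        rw [show (i + 1) * (n + 1) = i * (n + 1) + n + 1 by ring, pow_succ, pow_add]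
        linear_combination (-(-1 : K) ^ (i * (n + 1))) * hsgn n
    have t2 : (-1 : K) ^ n • (-1 : K) ^ (m + 1) •
          ∑ k ∈ Finset.range (m + 1), (-1 : K) ^ (k * (n + 1)) • Q k
        = - (-1 : K) ^ (m + n) • ∑ i ∈ Finset.range m, (-1 : K) ^ (i * (n + 1)) • Q i
          - ((-1 : K) ^ n * (-1 : K) ^ (m * n)) • Q m := by
      rw [Finset.sum_range_succ, smul_add, smul_add, sub_eq_add_neg, ← neg_smul]
      congr 1
      · rw [smul_smul]; congr 1; ring
      · rw [smul_smul, smul_smul]; congr 1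
        rw [show m * (n + 1) = m * n + m by ring, pow_succ, pow_add]
        linear_combination (-(-1 : K) ^ n * (-1 : K) ^ (m * n)) * hsgn m
    have t3 : (-1 : K) ^ n • ∑ i ∈ Finset.range m, (-1 : K) ^ (i + 1) •
            ∑ k ∈ Finset.range (m + 2 - 1), (-1 : K) ^ (k * (n + 1)) • Y i k
        = - ∑ i ∈ Finset.range m, ∑ j ∈ Finset.range m,
            (if j < i then (-1 : K) ^ (j * (n + 1) + i + n) • Y i j else 0)
          + ∑ i ∈ Finset.range m, (-1 : K) ^ (i * n) • (-1 : K) ^ (n + 1) • Y i i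
          + ∑ i ∈ Finset.range m, (-1 : K) ^ (i * n) • Y i (i + 1)
          - ∑ i ∈ Finset.range m, ∑ p ∈ Finset.range m,
            (if i < p then (-1 : K) ^ (p * (n + 1) + i + 1) • Y i (p + 1) else 0) := by
      rw [sub_eq_add_neg, Finset.smul_sum]
      simp only [← Finset.sum_neg_distrib, ← Finset.sum_add_distrib]
      refine Finset.sum_congr rfl fun i hi => ?_
      rw [hYs i hi]
      simp only [smul_add, Finset.smul_sum, smul_ite, smul_zero, smul_smul]
      simp only [← add_assoc]
      congr 1
      · congr 1
        · congr 1
          · refine Finset.sum_congr rfl fun j _ => ?_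
            split_ifs
            · rw [← neg_smul]; congr 1; ring
            · simp
          · congr 1
            rw [show i * (n + 1) = i * n + i by ring, pow_add, pow_add, pow_add]
            linear_combination (-(-1 : K) ^ n * (-1 : K) ^ (i * n)) * hsgn i
        · congr 1
          rw [show (i + 1) * (n + 1) = i * n + i + n + 1 by ring, pow_add, pow_add, pow_add,
            pow_add]
          linear_combination ((-1 : K) ^ n * (-1 : K) ^ n * (-1 : K) ^ (i * n)) * hsgn i
            + (-1 : K) ^ (i * n) * hsgn n
      · refine Finset.sum_congr rfl fun p _ => ?_
        split_ifs
        · rw [← neg_smul]; congr 1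
          rw [show (p + 1) * (n + 1) = p * (n + 1) + n + 1 by ring, pow_add, pow_add, pow_add,
            pow_add, pow_add]
          linear_combination ((-1 : K) ^ (p * (n + 1)) * (-1 : K) ^ i) * hsgn n
        · simp
    rw [hB, smul_add, smul_add, t1, t2, t3]
    module
  have hT1 : ∑ i ∈ Finset.range m, ∑ j ∈ Finset.range m,
        (if j < i then (-1 : K) ^ (i * (n + 1) + j + 1) • Y j (i + 1) else 0)
      = ∑ i ∈ Finset.range m, ∑ p ∈ Finset.range m,
        (if i < p then (-1 : K) ^ (p * (n + 1) + i + 1) • Y i (p + 1) else 0) :=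
    Finset.sum_comm
  have hT2 : ∑ i ∈ Finset.range m, ∑ p ∈ Finset.range m,
        (if i < p then (-1 : K) ^ (i * (n + 1) + p + n) • Y p i else 0)
      = ∑ i ∈ Finset.range m, ∑ j ∈ Finset.range m,
        (if j < i then (-1 : K) ^ (j * (n + 1) + i + n) • Y i j else 0) :=
    Finset.sum_comm
  rw [hA', hB', hC, hT1, hT2, ← hP0, ← hQm]
  simp only [smul_add, Finset.sum_add_distrib]
  module

/-! ### Hochschild cohomology -/

/-- The cup product as a bilinear map. -/
def cupL (m n : ℕ) : Cochain K A m →ₗ[K] Cochain K A n →ₗ[K] Cochain K A (m + n) :=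
  LinearMap.mk₂ K cup
    (fun f f' g => by ext a; simp [cup, ofSlots_apply, add_mul])
    (fun c f g => by ext a; simp [cup, ofSlots_apply])
    (fun f g g' => by ext a; simp [cup, ofSlots_apply, mul_add])
    (fun c f g => by ext a; simp [cup, ofSlots_apply])

/-- The product `•` as a bilinear map. -/
def preLieL (m n : ℕ) : Cochain K A m →ₗ[K] Cochain K A n →ₗ[K] Cochain K A (m + n - 1) :=
  LinearMap.mk₂ K preLie
    (fun f f' g => by
      apply ev_injective
      simp only [map_add, ev_preLie, ← Finset.sum_add_distrib, ← smul_add]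
      rfl)
    (fun c f g => by
      apply ev_injective
      simp only [map_smul, ev_preLie, Finset.smul_sum]
      exact Finset.sum_congr rfl fun i _ =>
        smul_comm ((-1 : K) ^ (i * (n + 1))) c (rc (ev f) i n (ev g)))
    (fun f g g' => by
      apply ev_injective
      simp only [map_add, ev_preLie, ← Finset.sum_add_distrib, ← smul_add]
      exact Finset.sum_congr rfl fun i hi => congrArg (fun t => (-1 : K) ^ (i * (n + 1)) • t)
        (map_add (rcR f i (Finset.mem_range.1 hi) n) (ev g) (ev g')))
    (fun c f g => by
      apply ev_injective
      simp only [map_smul, ev_preLie, Finset.smul_sum]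
      refine Finset.sum_congr rfl fun i hi => ?_
      rw [smul_comm c]
      exact congrArg (fun t => (-1 : K) ^ (i * (n + 1)) • t)
        (map_smul (rcR f i (Finset.mem_range.1 hi) n) c (ev g)))

/-- The Gerstenhaber bracket on cochains,
`{f, g} = f • g - (-1)^{(m-1)(n-1)} g • f ∈ C^{m+n-1}(A, A)`. For `m = n = 0` (where the degree
`m + n - 1` would be `-1`) it is `0`. -/
def bracketCochain {m n : ℕ} (f : Cochain K A m) (g : Cochain K A n) : Cochain K A (m + n - 1) :=
  preLie f g - (-1 : K) ^ ((m + 1) * (n + 1)) • castDeg (by rw [add_comm]) (preLie g f)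

/-- The bracket as a bilinear map. -/
def bracketL (m n : ℕ) : Cochain K A m →ₗ[K] Cochain K A n →ₗ[K] Cochain K A (m + n - 1) :=
  LinearMap.mk₂ K bracketCochain
    (fun f f' g => by
      have h1 : preLie (f + f') g = preLie f g + preLie f' g := LinearMap.map_add₂ (preLieL m n) f f' g
      have h2 : preLie g (f + f') = preLie g f + preLie g f' := map_add (preLieL n m g) f f'
      rw [bracketCochain, bracketCochain, bracketCochain, h1, h2, map_add]; module)
    (fun c f g => by
      have h1 : preLie (c • f) g = c • preLie f g := LinearMap.map_smul₂ (preLieL m n) c f g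
      have h2 : preLie g (c • f) = c • preLie g f := map_smul (preLieL n m g) c f
      rw [bracketCochain, bracketCochain, h1, h2, map_smul]; module)
    (fun f g g' => by
      have h1 : preLie (g + g') f = preLie g f + preLie g' f := LinearMap.map_add₂ (preLieL n m) g g' f
      have h2 : preLie f (g + g') = preLie f g + preLie f g' := map_add (preLieL m n f) g g'
      rw [bracketCochain, bracketCochain, bracketCochain, h1, h2, map_add]; module)
    (fun c f g => by
      have h1 : preLie (c • g) f = c • preLie g f := LinearMap.map_smul₂ (preLieL n m) c g f
      have h2 : preLie f (c • g) = c • preLie f g := map_smul (preLieL m n f) c g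
      rw [bracketCochain, bracketCochain, h1, h2, map_smul]; module)

/-- The squaring map on cochains of even degree, `sq(f) = f • f ∈ C^{4n-1}(A, A)`. For `n = 0` it
is `0`. -/
def sqCochain (n : ℕ) (f : Cochain K A (2 * n)) : Cochain K A (4 * n - 1) :=
  castDeg (by omega) (preLie f f)

lemma ev_bracketL {m n : ℕ} (f : Cochain K A m) (g : Cochain K A n) :
    ev (bracketL m n f g)
      = ev (preLie f g) - (-1 : K) ^ ((m + 1) * (n + 1)) • ev (preLie g f) := by
  have : bracketL m n f g = preLie f g - (-1 : K) ^ ((m + 1) * (n + 1)) •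
      castDeg (by rw [add_comm]) (preLie g f) := rfl
  rw [this, map_sub, map_smul, ev_castDeg]

variable (K A)

/-- Hochschild `n`-cocycles. -/
def cocycles (n : ℕ) : Submodule K (Cochain K A n) := LinearMap.ker (d n)

/-- Hochschild `n`-coboundaries. -/
def coboundaries : (n : ℕ) → Submodule K (Cochain K A n)
  | 0 => ⊥
  | n + 1 => LinearMap.range (d n)

instance (n : ℕ) : AddCommGroup (cocycles K A n) := Submodule.addCommGroup _

instance (n : ℕ) : Module K (cocycles K A n) := Submodule.module _

/-- The Hochschild cohomology module `HHⁿ(A) = Hⁿ(C(A, A), ∂)`: cocycles modulo coboundaries. -/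
def HH (n : ℕ) : Type _ := cocycles K A n ⧸ (coboundaries K A n).submoduleOf (cocycles K A n)

instance (n : ℕ) : AddCommGroup (HH K A n) :=
  inferInstanceAs (AddCommGroup
    (cocycles K A n ⧸ (coboundaries K A n).submoduleOf (cocycles K A n)))

instance (n : ℕ) : Module K (HH K A n) :=
  inferInstanceAs (Module K
    (cocycles K A n ⧸ (coboundaries K A n).submoduleOf (cocycles K A n)))

variable {K A}

/-- The cohomology class of a cocycle. -/
def HH.mk (n : ℕ) : cocycles K A n →ₗ[K] HH K A n := Submodule.mkQ _

lemma HH.mk_surjective (n : ℕ) : Function.Surjective (HH.mk n : cocycles K A n → HH K A n) :=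
  Submodule.mkQ_surjective _

lemma HH.mk_eq_mk {n : ℕ} {f g : cocycles K A n} :
    HH.mk n f = HH.mk n g ↔ (f : Cochain K A n) - g ∈ coboundaries K A n :=
  Submodule.Quotient.eq _

lemma HH.mk_eq_zero {n : ℕ} {f : cocycles K A n} :
    HH.mk n f = 0 ↔ (f : Cochain K A n) ∈ coboundaries K A n :=
  Submodule.Quotient.mk_eq_zero _

/-- A bilinear map on cochains that is compatible with cocycles and coboundaries induces a
bilinear map in cohomology. -/
def HH.lift₂ {m n p : ℕ} (B : Cochain K A m →ₗ[K] Cochain K A n →ₗ[K] Cochain K A p)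
    (hZ : ∀ f ∈ cocycles K A m, ∀ g ∈ cocycles K A n, B f g ∈ cocycles K A p)
    (hl : ∀ f ∈ coboundaries K A m, f ∈ cocycles K A m → ∀ g ∈ cocycles K A n,
      B f g ∈ coboundaries K A p)
    (hr : ∀ f ∈ cocycles K A m, ∀ g ∈ coboundaries K A n, g ∈ cocycles K A n →
      B f g ∈ coboundaries K A p) :
    HH K A m →ₗ[K] HH K A n →ₗ[K] HH K A p :=
  let B' : cocycles K A m →ₗ[K] cocycles K A n →ₗ[K] HH K A p :=
    LinearMap.mk₂ K (fun f g => HH.mk p ⟨B f g, hZ f f.2 g g.2⟩)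
      (fun f f' g => by rw [← map_add]; congr 1; ext1; simp)
      (fun c f g => by rw [← map_smul]; congr 1; ext1; simp)
      (fun f g g' => by rw [← map_add]; congr 1; ext1; simp)
      (fun c f g => by rw [← map_smul]; congr 1; ext1; simp)
  let B'' : cocycles K A m →ₗ[K] HH K A n →ₗ[K] HH K A p :=
    { toFun f := Submodule.liftQ _ (B' f) (fun g hg =>
        LinearMap.mem_ker.2 (HH.mk_eq_zero.2 (hr f f.2 g hg g.2)))
      map_add' f f' := by
        ext x
        obtain ⟨g, rfl⟩ := HH.mk_surjective _ x
        exact LinearMap.congr_fun (map_add B' f f') g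
      map_smul' c f := by
        ext x
        obtain ⟨g, rfl⟩ := HH.mk_surjective _ x
        exact LinearMap.congr_fun (map_smul B' c f) g }
  Submodule.liftQ _ B'' (fun f hf => LinearMap.mem_ker.2 (by
    ext x
    obtain ⟨g, rfl⟩ := HH.mk_surjective _ x
    exact HH.mk_eq_zero.2 (hl f hf f.2 g g.2)))

lemma HH.lift₂_mk {m n p : ℕ} (B : Cochain K A m →ₗ[K] Cochain K A n →ₗ[K] Cochain K A p)
    (hZ hl hr) (f : cocycles K A m) (g : cocycles K A n) :
    HH.lift₂ B hZ hl hr (HH.mk m f) (HH.mk n g) = HH.mk p ⟨B f g, hZ f f.2 g g.2⟩ := rfl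

lemma mem_cocycles_iff {n : ℕ} {f : Cochain K A n} : f ∈ cocycles K A n ↔ ev (d n f) = 0 := by
  rw [cocycles, LinearMap.mem_ker]
  exact ⟨fun h => by rw [h, map_zero], fun h => ev_injective (by rw [h, map_zero])⟩

lemma d_eq_zero {n : ℕ} {f : Cochain K A n} (hf : f ∈ cocycles K A n) : d n f = 0 := hf

lemma mem_coboundaries_of_ev {n k : ℕ} {f : Cochain K A n} (h : Cochain K A k)
    (hk : n = k + 1 ∨ h = 0) (he : ev f = ev (d k h)) : f ∈ coboundaries K A n := by
  rcases hk with rfl | rfl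
  · exact ⟨h, ev_injective he.symm⟩
  · have : f = 0 := ev_injective (by rw [he, map_zero, map_zero, map_zero])
    rw [this]; exact zero_mem _

lemma exists_of_mem_coboundaries {n : ℕ} {f : Cochain K A n} (hf : f ∈ coboundaries K A n) :
    f = 0 ∨ ∃ k, ∃ _ : n = k + 1, ∃ h : Cochain K A k, ev f = ev (d k h) := by
  cases n with
  | zero => exact Or.inl hf
  | succ k => obtain ⟨h, rfl⟩ := hf; exact Or.inr ⟨k, rfl, h, rfl⟩

lemma cup_mem_cocycles {m n : ℕ} (f : Cochain K A m) (hf : f ∈ cocycles K A m)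
    (g : Cochain K A n) (hg : g ∈ cocycles K A n) : cup f g ∈ cocycles K A (m + n) := by
  rw [mem_cocycles_iff, ev_d_cup, d_eq_zero hf, d_eq_zero hg]
  ext a
  simp [ev_cup]

lemma cup_mem_coboundaries_left {m n : ℕ} (f : Cochain K A m) (hf : f ∈ coboundaries K A m)
    (g : Cochain K A n) (hg : g ∈ cocycles K A n) : cup f g ∈ coboundaries K A (m + n) := by
  cases m with
  | zero =>
    have : f = 0 := hf
    have h0 : cup f g = 0 := by ext a; simp [this, cup, ofSlots_apply]
    rw [h0]; exact zero_mem _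
  | succ k =>
    obtain ⟨h, rfl⟩ := hf
    refine mem_coboundaries_of_ev (cup h g) (Or.inl (by omega)) ?_
    rw [ev_d_cup, d_eq_zero hg]
    ext a
    simp [ev_cup]

lemma cup_mem_coboundaries_right {m n : ℕ} (f : Cochain K A m) (hf : f ∈ cocycles K A m)
    (g : Cochain K A n) (hg : g ∈ coboundaries K A n) : cup f g ∈ coboundaries K A (m + n) := by
  cases n with
  | zero =>
    have : g = 0 := hg
    have h0 : cup f g = 0 := by ext a; simp [this, cup, ofSlots_apply]
    rw [h0]; exact zero_mem _
  | succ k =>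
    obtain ⟨h, rfl⟩ := hg
    refine mem_coboundaries_of_ev ((-1 : K) ^ m • cup f h) (Or.inl (by omega)) ?_
    rw [map_smul, map_smul, ev_d_cup, d_eq_zero hf]
    ext a
    simp [ev_cup, smul_smul, sign_sq]

lemma ev_preLie_zero_left {m n : ℕ} (g : Cochain K A n) :
    ev (preLie (0 : Cochain K A m) g) = 0 := by
  have : preLieL m n 0 g = 0 := by simp
  exact (congrArg ev this).trans (map_zero _)

lemma ev_preLie_zero_right {m n : ℕ} (f : Cochain K A m) :
    ev (preLie f (0 : Cochain K A n)) = 0 := by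
  have : preLieL m n f 0 = 0 := by simp
  exact (congrArg ev this).trans (map_zero _)

lemma ev_d_castDeg {m n : ℕ} (h : m = n) (f : Cochain K A m) :
    ev (d n (castDeg h f)) = ev (d m f) := by
  subst h; rfl

lemma bracket_mem_cocycles {m n : ℕ} (f : Cochain K A m) (hf : f ∈ cocycles K A m)
    (g : Cochain K A n) (hg : g ∈ cocycles K A n) :
    bracketL m n f g ∈ cocycles K A (m + n - 1) := by
  have e : bracketL m n f g = preLie f g - (-1 : K) ^ ((m + 1) * (n + 1)) •
      castDeg (by rw [add_comm]) (preLie g f) := rfl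
  have h1 := ev_d_preLie f g
  have h2 := ev_d_preLie g f
  rw [d_eq_zero hf, d_eq_zero hg, ev_preLie_zero_left, ev_preLie_zero_right, smul_zero, add_zero,
    zero_add] at h1 h2
  rw [mem_cocycles_iff, e, map_sub, map_sub, map_smul, map_smul, ev_d_castDeg, h1, h2,
    mul_comm n m, show (m + 1) * (n + 1) = m * n + m + n + 1 by ring]
  simp only [pow_add, pow_one]
  have hm := sign_sq (K := K) m
  have hn := sign_sq (K := K) (m * n)
  set u := (-1 : K) ^ m
  set v := (-1 : K) ^ n
  set w := (-1 : K) ^ (m * n)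
  have : v • (ev (cup g f) - w • ev (cup f g)) - (w * u * v * -1) • u •
      (ev (cup f g) - w • ev (cup g f))
      = (v - w * w * (u * u) * v) • ev (cup g f)
        + (w * v * (u * u) - v * w) • ev (cup f g) := by module
  rw [this, hm, hn]
  have e1 : v - 1 * 1 * v = 0 := by ring
  have e2 : w * v * 1 - v * w = 0 := by ring
  rw [e1, e2, zero_smul, zero_smul, add_zero]

lemma bracket_d_right {m k : ℕ} (f : Cochain K A m) (hf : f ∈ cocycles K A m)
    (h : Cochain K A k) : ev (bracketL m (k + 1) f (d k h))
      = ev (d (m + k - 1) (preLie f h + (-1 : K) ^ (m * k + k + m) •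
        castDeg (by rw [add_comm]) (preLie h f))) := by
  have h1 := ev_d_preLie f h
  have h2 := ev_d_preLie h f
  rw [d_eq_zero hf, ev_preLie_zero_left, smul_zero, add_zero] at h1
  rw [d_eq_zero hf, ev_preLie_zero_right, zero_add] at h2
  rw [ev_bracketL, map_add, map_add, map_smul, map_smul, ev_d_castDeg,
    show (m + 1) * (k + 1 + 1) = m * k + k + 2 * (m + 1) by ring, pow_add _ _ (2 * (m + 1)),
    pow_mul _ 2, neg_one_sq, one_pow, mul_one]
  rw [mul_comm k m] at h2
  simp only [pow_add]
  have hm := sign_sq (K := K) m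
  have hk := sign_sq (K := K) k
  have hn := sign_sq (K := K) (m * k)
  set u := (-1 : K) ^ m
  set v := (-1 : K) ^ k
  set w := (-1 : K) ^ (m * k)
  have h3 : ev (preLie (d k h) f) = (u * u) • ev (preLie (d k h) f) := by rw [hm, one_smul]
  have h4 : ev (preLie (d k h) f)
      = (u * u) • (ev (cup f h) - w • ev (cup h f)) - u • ev (d (k + m - 1) (preLie h f)) := by
    rw [h3]
    linear_combination (norm := module) u • h2
  rw [hm, one_smul] at h4
  have h5 : v • ev (cup h f) = (w * w) • v • ev (cup h f) := by rw [hn, one_smul]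
  rw [h4]
  linear_combination (norm := module) -h1 - h5

lemma bracketL_swap {m n : ℕ} (f : Cochain K A m) (g : Cochain K A n) :
    ev (bracketL n m g f) = -((-1 : K) ^ ((m + 1) * (n + 1)) • ev (bracketL m n f g)) := by
  rw [ev_bracketL, ev_bracketL, mul_comm (n + 1), smul_sub, smul_smul, sign_sq, one_smul, neg_sub]

lemma bracket_mem_coboundaries_right {m n : ℕ} (f : Cochain K A m) (hf : f ∈ cocycles K A m)
    (g : Cochain K A n) (hg : g ∈ coboundaries K A n) :
    bracketL m n f g ∈ coboundaries K A (m + n - 1) := by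
  cases n with
  | zero =>
    have : g = 0 := hg
    rw [this, map_zero]; exact zero_mem _
  | succ k =>
    obtain ⟨h, rfl⟩ := hg
    refine mem_coboundaries_of_ev _ ?_ (bracket_d_right f hf h)
    rcases Nat.eq_zero_or_pos (m + k) with h0 | h0
    · right
      obtain ⟨rfl, rfl⟩ : m = 0 ∧ k = 0 := by omega
      apply ev_injective
      rw [map_add, map_smul, ev_castDeg, ev_preLie, ev_preLie]
      simp
    · left; omega

lemma bracket_mem_coboundaries_left {m n : ℕ} (f : Cochain K A m) (hf : f ∈ coboundaries K A m)
    (g : Cochain K A n) (hg : g ∈ cocycles K A n) :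
    bracketL m n f g ∈ coboundaries K A (m + n - 1) := by
  have h := bracket_mem_coboundaries_right g hg f hf
  have key : ∀ {p q : ℕ} (hpq : p = q) (x : Cochain K A p) (y : Cochain K A q) (c : K),
      ev y = -(c • ev x) → x ∈ coboundaries K A p → y ∈ coboundaries K A q := by
    rintro p q rfl x y c he hx
    have : y = -(c • x) := ev_injective (by rw [he, map_neg, map_smul])
    rw [this]
    exact neg_mem (Submodule.smul_mem _ _ hx)
  exact key (by rw [add_comm]) _ _ _ (bracketL_swap g f) h

lemma sq_mem_cocycles {n : ℕ} (f : Cochain K A (2 * n)) (hf : f ∈ cocycles K A (2 * n)) :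
    sqCochain n f ∈ cocycles K A (4 * n - 1) := by
  have h1 := ev_d_preLie f f
  rw [d_eq_zero hf, ev_preLie_zero_left, ev_preLie_zero_right, smul_zero, add_zero,
    zero_add, mul_assoc 2 n, pow_mul _ 2 (n * _), neg_one_sq, one_pow, one_smul, sub_self,
    smul_zero] at h1
  rw [mem_cocycles_iff, sqCochain, ev_d_castDeg, h1]

lemma preLie_d_self {k n : ℕ} (hk : 2 * n = k + 1) (h : Cochain K A k)
    (hh : d k h ∈ cocycles K A (k + 1)) : ev (preLie (d k h) (d k h))
      = ev (d (k + k) (cup h h)) - ev (d (k + (k + 1) - 1) (preLie h (d k h))) := by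
  have h1 := ev_d_preLie h (d k h)
  have s1 : (-1 : K) ^ (k + 1) = 1 := by rw [← hk, pow_mul]; simp
  have s2 : (-1 : K) ^ (k * (k + 1)) = 1 := by rw [mul_comm, pow_mul, s1, one_pow]
  have s3 : (-1 : K) ^ k = -1 := by
    have := s1; rw [pow_succ] at this; linear_combination -this
  rw [s1, s2, d_eq_zero hh, ev_preLie_zero_right, zero_add, one_smul, one_smul, one_smul] at h1
  rw [ev_d_cup, s3, neg_one_smul, ← sub_eq_add_neg, ← h1, add_sub_cancel_left]

lemma sq_congr {n : ℕ} (f g : Cochain K A (2 * n)) (hg : g ∈ cocycles K A (2 * n))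
    (he : f - g ∈ cocycles K A (2 * n)) (hfg : f - g ∈ coboundaries K A (2 * n)) :
    sqCochain n f - sqCochain n g ∈ coboundaries K A (4 * n - 1) := by
  obtain ⟨e, rfl⟩ : ∃ e, f = g + e := ⟨f - g, by abel⟩
  rw [add_sub_cancel_left] at he hfg
  have key : ∀ {p q : ℕ} (hpq : p = q) (x : Cochain K A p), x ∈ coboundaries K A p →
      castDeg hpq x ∈ coboundaries K A q := by
    rintro p q rfl x hx; exact hx
  have hs : (-1 : K) ^ ((2 * n + 1) * (2 * n + 1)) = -1 := by
    rw [show (2 * n + 1) * (2 * n + 1) = 2 * (2 * n * n + 2 * n) + 1 by ring, pow_succ, pow_mul]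
    simp
  have hadd : ev (preLie (g + e) (g + e)) = ev (preLie g g) + ev (preLie e e)
      + ev (bracketL (2 * n) (2 * n) g e) := by
    have : preLieL (2 * n) (2 * n) (g + e) (g + e) = preLieL _ _ g g + preLieL _ _ e e
        + (preLieL _ _ g e + preLieL _ _ e g) := by
      simp only [map_add, LinearMap.add_apply]; abel
    rw [ev_bracketL, hs, neg_one_smul, sub_neg_eq_add]
    exact (congrArg ev this).trans (by simp only [map_add]; rfl)
  have h1 : sqCochain n (g + e) - sqCochain n g = sqCochain n e
      + castDeg (by omega) (bracketL (2 * n) (2 * n) g e) := by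
    apply ev_injective
    simp only [map_sub, map_add, sqCochain, ev_castDeg, hadd]
    abel
  rw [h1]
  refine add_mem ?_ (key _ _ (bracket_mem_coboundaries_right g hg e hfg))
  rcases exists_of_mem_coboundaries hfg with h0 | ⟨k, hk, h, hh⟩
  · have : sqCochain n e = 0 := by
      apply ev_injective
      rw [sqCochain, ev_castDeg, h0, ev_preLie_zero_left, map_zero]
    rw [this]; exact zero_mem _
  · have h2 : castDeg hk e = d k h := ev_injective (by rw [ev_castDeg, hh])
    have h3 : d k h ∈ cocycles K A (k + 1) := by
      rw [← h2, mem_cocycles_iff, ev_d_castDeg, d_eq_zero he, map_zero]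
    have h4 : ev (preLie e e) = ev (preLie (d k h) (d k h)) := by
      rw [ev_preLie, ev_preLie, hh, hk]
    have h5 : k + (k + 1) - 1 = k + k := by omega
    refine mem_coboundaries_of_ev (cup h h - castDeg h5 (preLie h (d k h)))
      (Or.inl (by omega)) ?_
    rw [sqCochain, ev_castDeg, h4, preLie_d_self hk h h3, map_sub, map_sub, ev_d_castDeg]

/-- The cup product in Hochschild cohomology. -/
def HH.cup (m n : ℕ) : HH K A m →ₗ[K] HH K A n →ₗ[K] HH K A (m + n) :=
  HH.lift₂ (cupL m n) cup_mem_cocycles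
    (fun f hf _ g hg => cup_mem_coboundaries_left f hf g hg)
    (fun f hf g hg _ => cup_mem_coboundaries_right f hf g hg)

/-- The Gerstenhaber bracket in Hochschild cohomology. -/
def HH.bracket (m n : ℕ) : HH K A m →ₗ[K] HH K A n →ₗ[K] HH K A (m + n - 1) :=
  HH.lift₂ (bracketL m n) bracket_mem_cocycles
    (fun f hf _ g hg => bracket_mem_coboundaries_left f hf g hg)
    (fun f hf g hg _ => bracket_mem_coboundaries_right f hf g hg)

/-- The class of `f • f`, for a cocycle `f` of even degree. -/
def sqCocycle (n : ℕ) (f : cocycles K A (2 * n)) : HH K A (4 * n - 1) :=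
  HH.mk (4 * n - 1) ⟨sqCochain n f.1, sq_mem_cocycles f.1 f.2⟩

lemma sqCocycle_congr (n : ℕ) (f g : cocycles K A (2 * n))
    (h : HH.mk (2 * n) f = HH.mk (2 * n) g) : sqCocycle n f = sqCocycle n g :=
  HH.mk_eq_mk.2 (sq_congr f.1 g.1 g.2 (sub_mem f.2 g.2) (HH.mk_eq_mk.1 h))

/-- The squaring map `HH²ⁿ(A) → HH⁴ⁿ⁻¹(A)`, the class of `f` going to the class of `f • f`. -/
def HH.sq (n : ℕ) (x : HH K A (2 * n)) : HH K A (4 * n - 1) :=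
  Quotient.lift (s := Submodule.quotientRel _) (sqCocycle n)
    (fun f g h => sqCocycle_congr n f g (Quotient.sound h)) x

lemma HH.cup_mk {m n : ℕ} (f : cocycles K A m) (g : cocycles K A n) :
    HH.cup m n (HH.mk m f) (HH.mk n g)
      = HH.mk (m + n) ⟨Hochschild.cup f.1 g.1, cup_mem_cocycles f.1 f.2 g.1 g.2⟩ :=
  HH.lift₂_mk _ _ _ _ f g

lemma HH.bracket_mk {m n : ℕ} (f : cocycles K A m) (g : cocycles K A n) :
    HH.bracket m n (HH.mk m f) (HH.mk n g)
      = HH.mk (m + n - 1) ⟨bracketL m n f.1 g.1, bracket_mem_cocycles f.1 f.2 g.1 g.2⟩ :=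
  HH.lift₂_mk _ _ _ _ f g

lemma HH.sq_mk {n : ℕ} (f : cocycles K A (2 * n)) :
    HH.sq n (HH.mk (2 * n) f)
      = HH.mk (4 * n - 1) ⟨sqCochain n f.1, sq_mem_cocycles f.1 f.2⟩ := rfl

/-! ### The graded algebra `HH*(A)` -/

/-- An element of `A` as a `0`-cochain. -/
def const (x : A) : Cochain K A 0 := MultilinearMap.constOfIsEmpty K _ x

lemma ev_const (x : A) (a : ℕ → A) : ev (const x : Cochain K A 0) a = x := rfl

lemma const_mem_cocycles (r : K) :
    (const (algebraMap K A r) : Cochain K A 0) ∈ cocycles K A 0 := by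
  rw [mem_cocycles_iff, ev_d]
  ext a
  simp [rl, rr, ev_const, Algebra.commutes]

/-- The structure map `K → HH⁰(A)`. -/
def HH.scalar : K →+ HH K A 0 where
  toFun r := HH.mk 0 ⟨const (algebraMap K A r), const_mem_cocycles r⟩
  map_zero' := by
    rw [HH.mk_eq_zero]
    have : (const (algebraMap K A 0) : Cochain K A 0) = 0 := by ext; simp [const]
    change const (algebraMap K A 0) ∈ coboundaries K A 0
    rw [this]; exact zero_mem _
  map_add' r s := by
    rw [← map_add]; congr 1; ext a; simp [const]

lemma gradedMk_eq {m n : ℕ} (h : m = n) (f : cocycles K A m) (g : cocycles K A n)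
    (he : ev f.1 = ev g.1) :
    GradedMonoid.mk (A := HH K A) m (HH.mk m f) = GradedMonoid.mk n (HH.mk n g) := by
  subst h
  rw [Subtype.ext (ev_injective he)]

instance : GradedMonoid.GMul (HH K A) where
  mul x y := HH.cup _ _ x y

instance : GradedMonoid.GOne (HH K A) where
  one := HH.scalar 1

lemma HH.scalar_mul (r : K) {n : ℕ} (x : HH K A n) :
    GradedMonoid.mk 0 (HH.scalar r) * GradedMonoid.mk n x = GradedMonoid.mk n (r • x) := by
  obtain ⟨f, rfl⟩ := HH.mk_surjective _ x
  rw [← map_smul]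
  refine gradedMk_eq (zero_add n) _ (r • f) ?_
  ext a
  change ev (Hochschild.cup _ _) a = ev (r • f.1) a
  rw [ev_cup, ev_const, map_smul, Pi.smul_apply, ← Algebra.smul_def]
  rfl

lemma HH.mul_scalar (r : K) {n : ℕ} (x : HH K A n) :
    GradedMonoid.mk n x * GradedMonoid.mk 0 (HH.scalar r) = GradedMonoid.mk n (r • x) := by
  obtain ⟨f, rfl⟩ := HH.mk_surjective _ x
  rw [← map_smul]
  refine gradedMk_eq (add_zero n) _ (r • f) ?_
  ext a
  change ev (Hochschild.cup _ _) a = ev (r • f.1) a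
  rw [ev_cup, ev_const, map_smul, Pi.smul_apply, ← Algebra.commutes, ← Algebra.smul_def]

instance : DirectSum.GRing (HH K A) where
  mul_zero _ := map_zero _
  zero_mul _ := LinearMap.map_zero₂ _ _
  mul_add _ _ _ := map_add _ _ _
  add_mul _ _ _ := LinearMap.map_add₂ _ _ _ _
  one_mul x := (HH.scalar_mul 1 x.2).trans (by rw [one_smul]; rfl)
  mul_one x := (HH.mul_scalar 1 x.2).trans (by rw [one_smul]; rfl)
  mul_assoc := by
    rintro ⟨m, x⟩ ⟨n, y⟩ ⟨p, z⟩
    obtain ⟨f, rfl⟩ := HH.mk_surjective _ x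
    obtain ⟨g, rfl⟩ := HH.mk_surjective _ y
    obtain ⟨h, rfl⟩ := HH.mk_surjective _ z
    refine gradedMk_eq (add_assoc m n p) ⟨cup (cup f.1 g.1) h.1, _⟩ ⟨cup f.1 (cup g.1 h.1), _⟩ ?_
    ext a
    have : shift n (shift m a) = shift (m + n) a := by
      ext k; simp only [shift]; congr 1; omega
    simp only [ev_cup, mul_assoc, this]
  natCast n := HH.scalar n
  natCast_zero := by simp
  natCast_succ n := by
    rw [Nat.cast_succ, map_add]; rfl
  intCast n := HH.scalar n
  intCast_ofNat n := by simp
  intCast_negSucc_ofNat n := by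
    rw [Int.cast_negSucc, map_neg]

instance : DirectSum.GAlgebra K (HH K A) where
  toFun := HH.scalar
  map_one := rfl
  map_mul r s := by
    refine Eq.trans ?_ (HH.scalar_mul r (HH.scalar s : HH K A 0)).symm
    congr 1
    change _ = r • HH.mk 0 _
    rw [← map_smul]
    change HH.mk 0 _ = _
    congr 1
    ext a
    simp [const, Algebra.smul_def]
  commutes r x := (HH.scalar_mul r x.2).trans (HH.mul_scalar r x.2).symm
  smul_def r x := (HH.scalar_mul r x.2).symm

variable (K A)

open DirectSum in
/-- The Hochschild cohomology algebra `HH*(A) = ⨁ₙ HHⁿ(A)`; it is a `K`-algebra under the cup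
product. -/
abbrev HHStar : Type _ := ⨁ n, HH K A n

variable {K A}

namespace HHStar

/-- The submodule of homogeneous elements of degree `n`. -/
def degree (n : ℕ) : Submodule K (HHStar K A) :=
  LinearMap.range (DirectSum.lof K ℕ (HH K A) n)

/-- The Gerstenhaber bracket on `HH*(A)`, of degree `-1`. -/
def bracket : HHStar K A →ₗ[K] HHStar K A →ₗ[K] HHStar K A :=
  DirectSum.toModule K ℕ _ fun m => LinearMap.flip <|
    DirectSum.toModule K ℕ _ fun n => LinearMap.flip <|
      (HH.bracket m n).compr₂ (DirectSum.lof K ℕ (HH K A) (m + n - 1))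

/-- The squaring map on `HH²ⁿ(A) ⊆ HH*(A)` (on an arbitrary element, it is applied to the
component of degree `2n`). -/
def sq (n : ℕ) (x : HHStar K A) : HHStar K A :=
  DirectSum.lof K ℕ (HH K A) (4 * n - 1) (HH.sq n (x (2 * n)))

lemma bracket_lof (m n : ℕ) (x : HH K A m) (y : HH K A n) :
    bracket (DirectSum.lof K ℕ (HH K A) m x) (DirectSum.lof K ℕ (HH K A) n y)
      = DirectSum.lof K ℕ (HH K A) (m + n - 1) (HH.bracket m n x y) := by
  simp [bracket]

lemma lof_mul_lof (m n : ℕ) (x : HH K A m) (y : HH K A n) :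
    DirectSum.lof K ℕ (HH K A) m x * DirectSum.lof K ℕ (HH K A) n y
      = DirectSum.lof K ℕ (HH K A) (m + n) (HH.cup m n x y) :=
  DirectSum.of_mul_of x y

lemma sq_lof (n : ℕ) (x : HH K A (2 * n)) :
    sq n (DirectSum.lof K ℕ (HH K A) (2 * n) x)
      = DirectSum.lof K ℕ (HH K A) (4 * n - 1) (HH.sq n x) := by
  rw [sq, DirectSum.lof_apply]

end HHStar

end

end Hochschild

/-! A decomposition of an algebra into finitely many factors is a decomposition of `1` into
orthogonal central idempotents, so everything is done one factor `B` of `A` at a time, with `e =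
incl 1` the corresponding idempotent. Restriction of cochains to the factor (`Factor.pull`) and
extension from it (`Factor.push`) are both morphisms of Hochschild complexes. Restriction after
extension is the identity on cochains, and extension from one factor followed by restriction to an
orthogonal one is zero.

The composite in the other order is `f ↦ e f(e a₀, e a₁, …)`. It agrees in cohomology with
multiplication of the values by `e`: the alternating sum of the terms `f(e a₀, …, e a_{j-1}, e, a_j,
…)` is a simplicial homotopy between evaluation at `a` and evaluation at `e a`, and
`ev_d_idemHomotopy` shows that it bounds the difference when `f` is a cocycle with values in `eA`.
Since the idempotents add up to `1`, every class is the sum of the extensions of its restrictions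
(`Factor.pushHH_pullHH`). Hence the restrictions are jointly injective, and the extensions supply
preimages.

It remains to see that restriction respects the operations. For the cup product this holds on
cochains. For `•` it fails on cochains: in `f(…, g(…), …)` the inner value may have components
outside the factor, on which the factor component of `f` may depend. Subtracting the coboundary
found above gives a cohomologous `f` whose component in the factor depends only on the factor
components of its arguments (`Factor.exists_adapted`). For such `f`, restriction commutes with `f •
g` on the nose (`Factor.pull_preLie`), which yields both the bracket and the squaring map. All the
constructions are explicit formulas on multilinear maps. -/

namespace Hochschild

noncomputable section

variable {K A B : Type*} [CommRing K] [Ring A] [Algebra K A] [Ring B]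
  [Algebra K B]

/-! ### The homotopy attached to a central idempotent -/

/-- The sequence `e a₀, …, e a_{j-1}, e, a_j, a_{j+1}, …`. -/
def insertIdem (e : A) (j : ℕ) (a : ℕ → A) (k : ℕ) : A :=
  if k < j then e * a k else if k = j then e else a (k - 1)

/-- The sequence `e a₀, …, e a_{j-1}, a_j, a_{j+1}, …`. -/
def scaleInit (e : A) (j : ℕ) (a : ℕ → A) (k : ℕ) : A :=
  if k < j then e * a k else a k

/-- `f(e a₀, …, e a_{j-1}, e, a_j, …, a_{n-1})`, as a cochain. -/
def insertIdemCochain (e : A) {n : ℕ} (f : Cochain K A (n + 1)) (j : Fin (n + 1)) :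
    Cochain K A n :=
  (f.compLinearMap fun k => if k ≤ j then LinearMap.mulLeft K e else LinearMap.id).curryMid j 1

lemma ev_insertIdemCochain (e : A) {n : ℕ} (f : Cochain K A (n + 1)) (j : Fin (n + 1))
    (a : ℕ → A) : ev (insertIdemCochain e f j) a = ev f (insertIdem e j a) := by
  rw [ev_apply, ev_apply, insertIdemCochain, MultilinearMap.curryMid_apply_apply,
    MultilinearMap.compLinearMap_apply]
  congr 1
  ext k
  induction k using Fin.succAboveCases j with
  -- Slot `j` is scaled by `e` as well, so plugging `1` into it produces `e`.
  | x => simp [insertIdem]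
  | p i =>
    rw [Fin.insertNth_apply_succAbove]
    rcases lt_or_ge i.castSucc j with h | h
    · rw [Fin.succAbove_of_castSucc_lt _ _ h, if_pos h.le]
      have hij : (i : ℕ) < j := h
      simp [insertIdem, hij]
    · rw [Fin.succAbove_of_le_castSucc _ _ h]
      have hij : (j : ℕ) ≤ i := h
      rw [if_neg (by rw [Fin.le_def, Fin.val_succ]; omega)]
      simp only [insertIdem, Fin.val_succ]
      rw [if_neg (by omega), if_neg (by omega)]
      rfl

/-- The contracting homotopy `∑ⱼ (-1)ʲ f(e a₀, …, e a_{j-1}, e, a_j, …, a_{n-1})`. -/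
def idemHomotopy (e : A) {n : ℕ} (f : Cochain K A (n + 1)) : Cochain K A n :=
  ∑ j : Fin (n + 1), (-1 : K) ^ (j : ℕ) • insertIdemCochain e f j

lemma ev_idemHomotopy (e : A) {n : ℕ} (f : Cochain K A (n + 1)) (a : ℕ → A) :
    ev (idemHomotopy e f) a
      = ∑ j ∈ Finset.range (n + 1), (-1 : K) ^ j • ev f (insertIdem e j a) := by
  simp only [idemHomotopy, map_sum, map_smul, Finset.sum_apply, Pi.smul_apply,
    ev_insertIdemCochain]
  rw [Finset.sum_range (fun j => (-1 : K) ^ j • ev f (insertIdem e j a))]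

/-! ### Face relations of the homotopy -/

lemma shift_insertIdem_zero (e : A) (a : ℕ → A) : shift 1 (insertIdem e 0 a) = a := by
  ext k; simp [shift, insertIdem]

lemma shift_insertIdem_succ (e : A) (j : ℕ) (a : ℕ → A) :
    shift 1 (insertIdem e (j + 1) a) = insertIdem e j (shift 1 a) := by
  ext k
  simp only [shift, insertIdem]
  split_ifs <;> first | omega | rfl | (congr 1; omega)

/-- Multiplication by a central idempotent is multiplicative, `(e a)(e b) = e (a b)`, so merging two
scaled entries ahead of the inserted `e` commutes with the insertion, whose position drops by one.
-/
lemma splice_insertIdem_before {e : A} (he : e * e = e) (hc : ∀ a, e * a = a * e) {i j : ℕ} (h : i < j)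
    (a : ℕ → A) :
    splice i 2 (mu (shift i (insertIdem e (j + 1) a))) (insertIdem e (j + 1) a)
      = insertIdem e j (splice i 2 (mu (shift i a)) a) := by
  have hm : (e * a i) * (e * a (1 + i)) = e * (a i * a (1 + i)) := by
    rw [mul_assoc, ← mul_assoc (a i), ← hc (a i), mul_assoc e, ← mul_assoc e e, he]
  ext k
  simp only [splice, insertIdem, mu, shift, zero_add]
  rw [if_pos (show i < j + 1 by omega), if_pos (show 1 + i < j + 1 by omega), hm]
  split_ifs <;> first | omega | rfl | (congr 1; omega)

/-- Here the inserted `e` is merged with its left neighbour, `(e a_j) e = e a_j`. The outcome is the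
same as in `splice_insertIdem_right`, where `e` is merged with its right neighbour; the two faces
occur with opposite signs and cancel. -/
lemma splice_insertIdem_left {e : A} (he : e * e = e) (hc : ∀ a, e * a = a * e) (j : ℕ)
    (a : ℕ → A) :
    splice j 2 (mu (shift j (insertIdem e (j + 1) a))) (insertIdem e (j + 1) a)
      = scaleInit e (j + 1) a := by
  ext k
  simp only [splice, insertIdem, scaleInit, mu, shift, zero_add]
  rw [if_pos (show j < j + 1 by omega), if_neg (show ¬ 1 + j < j + 1 by omega),
    if_pos (add_comm 1 j), ← hc (e * a j), ← mul_assoc, he]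
  split_ifs <;> first | omega | rfl | (congr 1; omega) | (subst_vars; rfl)

lemma splice_insertIdem_right (e : A) (j : ℕ) (a : ℕ → A) :
    splice j 2 (mu (shift j (insertIdem e j a))) (insertIdem e j a) = scaleInit e (j + 1) a := by
  ext k
  simp only [splice, insertIdem, scaleInit, mu, shift, zero_add]
  rw [if_neg (show ¬ j < j by omega), if_pos trivial, if_neg (show ¬ 1 + j < j by omega),
    if_neg (show ¬ 1 + j = j by omega), show 1 + j - 1 = j by omega]
  split_ifs <;> first | omega | rfl | (congr 1; omega) | (subst_vars; rfl)

lemma splice_insertIdem_after (e : A) {i j : ℕ} (h : j ≤ i) (a : ℕ → A) :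
    splice (i + 1) 2 (mu (shift (i + 1) (insertIdem e j a))) (insertIdem e j a)
      = insertIdem e j (splice i 2 (mu (shift i a)) a) := by
  ext k
  simp only [splice, insertIdem, mu, shift, zero_add]
  rw [if_neg (show ¬ i + 1 < j by omega), if_neg (show ¬ i + 1 = j by omega),
    if_neg (show ¬ 1 + (i + 1) < j by omega), if_neg (show ¬ 1 + (i + 1) = j by omega),
    show 1 + (i + 1) - 1 = 1 + i by omega, Nat.add_sub_cancel]
  split_ifs <;> first | omega | rfl | (congr 1; omega)

/-- Cancellation in the double sum of the inner faces of a simplicial homotopy. -/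
lemma sum_inner_faces {M : Type*} [AddCommGroup M] [Module K M] (n : ℕ) (F X : ℕ → ℕ → M)
    (G : ℕ → M) (h1 : ∀ i j, i < j → F i (j + 1) = X i j) (h2 : ∀ j, F j (j + 1) = G (j + 1))
    (h3 : ∀ j, F j j = G (j + 1)) (h4 : ∀ i j, j ≤ i → F (i + 1) j = X i j) :
    ∑ j ∈ Finset.range (n + 2), ∑ i ∈ Finset.range (n + 1), (-1 : K) ^ (i + j) • F i j
      = ∑ j ∈ Finset.range (n + 1), ∑ i ∈ Finset.range n, (-1 : K) ^ (i + j + 1) • X i j := by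
  -- The terms split into those with `i + 1 < j`, those with `j < i`, and the two diagonals `j = i`
  -- and `j = i + 1`. On both diagonals `F` equals `G (i + 1)`, with sign `+` on the first and `-`
  -- on the second.
  have s1 : ∀ i j, (-1 : K) ^ (i + j) • F i j
      = (if i + 1 < j then (-1 : K) ^ (i + j) • F i j else 0)
        + (if j < i then (-1 : K) ^ (i + j) • F i j else 0)
        + (if j = i then G (j + 1) else 0) + (if j = i + 1 then - G (i + 1) else 0) := by
    intro i j
    rcases lt_trichotomy i j with h | rfl | h
    · rcases Nat.lt_or_ge (i + 1) j with hij | hij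
      · simp [hij, h.le, h.ne', show j ≠ i + 1 by omega]
      · obtain rfl : j = i + 1 := by omega
        simp only [h2, lt_irrefl, if_false, if_true, show ¬ i + 1 < i by omega,
          show i + 1 ≠ i by omega]
        rw [show i + (i + 1) = 2 * i + 1 by ring, pow_succ, pow_mul]; simp
    · simp only [h3, lt_irrefl, if_false, if_true, show ¬ i + 1 < i by omega,
          show i ≠ i + 1 by omega]
      rw [show i + i = 2 * i by ring, pow_mul]; simp
    · simp [h, h.ne, show ¬ i + 1 < j by omega, show j ≠ i + 1 by omega]
  rw [Finset.sum_congr rfl fun j _ => Finset.sum_congr rfl fun i _ => s1 i j]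
  simp only [Finset.sum_add_distrib]
  -- Shift `j` by one; the row `j = 0` and, after the shift, the column `i = n` are empty.
  have p1 : ∑ j ∈ Finset.range (n + 2), ∑ i ∈ Finset.range (n + 1),
      (if i + 1 < j then (-1 : K) ^ (i + j) • F i j else 0)
      = ∑ j ∈ Finset.range (n + 1), ∑ i ∈ Finset.range n,
        (if i < j then (-1 : K) ^ (i + j + 1) • X i j else 0) := by
    rw [Finset.sum_range_succ' _ (n + 1)]
    simp only [Nat.not_lt_zero, if_false, Finset.sum_const_zero, add_zero]
    refine Finset.sum_congr rfl fun j hj => ?_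
    have hj := Finset.mem_range.1 hj
    rw [Finset.sum_range_succ, if_neg (by omega), add_zero]
    refine Finset.sum_congr rfl fun i _ => ?_
    by_cases h : i < j
    · rw [if_pos (by omega), if_pos h, h1 _ _ h, add_assoc]
    · rw [if_neg (by omega), if_neg h]
  -- Shift `i` by one; the row `j = n + 1` and the column `i = 0` are empty.
  have p2 : ∑ j ∈ Finset.range (n + 2), ∑ i ∈ Finset.range (n + 1),
      (if j < i then (-1 : K) ^ (i + j) • F i j else 0)
      = ∑ j ∈ Finset.range (n + 1), ∑ i ∈ Finset.range n,
        (if j ≤ i then (-1 : K) ^ (i + j + 1) • X i j else 0) := by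
    rw [Finset.sum_range_succ _ (n + 1), Finset.sum_eq_zero (s := Finset.range (n + 1))
      (f := fun i => if n + 1 < i then (-1 : K) ^ (i + (n + 1)) • F i (n + 1) else 0)
      (fun i hi => if_neg (by have := Finset.mem_range.1 hi; omega)), add_zero]
    refine Finset.sum_congr rfl fun j hj => ?_
    rw [Finset.sum_range_succ', if_neg (by omega), add_zero]
    refine Finset.sum_congr rfl fun i _ => ?_
    by_cases h : j ≤ i
    · rw [if_pos (by omega), if_pos h, h4 _ _ h, add_right_comm]
    · rw [if_neg (by omega), if_neg h]
  -- For `i ≤ n` both `i` and `i + 1` lie in the range of `j`, so each diagonal is met in full and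
  -- they cancel.
  have p3 : ∑ j ∈ Finset.range (n + 2), ∑ i ∈ Finset.range (n + 1),
      (if j = i then G (j + 1) else 0) = ∑ i ∈ Finset.range (n + 1), G (i + 1) := by
    rw [Finset.sum_comm]
    refine Finset.sum_congr rfl fun i hi => ?_
    rw [Finset.sum_ite_eq' _ i, if_pos (by simp at hi ⊢; omega)]
  have p4 : ∑ j ∈ Finset.range (n + 2), ∑ i ∈ Finset.range (n + 1),
      (if j = i + 1 then - G (i + 1) else 0) = - ∑ i ∈ Finset.range (n + 1), G (i + 1) := by
    rw [Finset.sum_comm, ← Finset.sum_neg_distrib]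
    refine Finset.sum_congr rfl fun i hi => ?_
    rw [Finset.sum_ite_eq' _ (i + 1), if_pos (by simp at hi ⊢; omega)]
  rw [p1, p2, p3, p4, add_neg_cancel_right, ← Finset.sum_add_distrib]
  refine Finset.sum_congr rfl fun j _ => ?_
  rw [← Finset.sum_add_distrib]
  refine Finset.sum_congr rfl fun i _ => ?_
  by_cases h : i < j
  · rw [if_pos h, if_neg (by omega), add_zero]
  · rw [if_neg h, if_pos (by omega), zero_add]

/-- For a central idempotent `e`, a cocycle `f` with values in `eA` is cohomologous to
`f(e a₀, …, e a_n)`. -/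
lemma ev_d_idemHomotopy {e : A} (he : e * e = e) (hc : ∀ a, e * a = a * e) {n : ℕ}
    (f : Cochain K A (n + 1)) (hf : f ∈ cocycles K A (n + 1)) (hef : ∀ a, e * ev f a = ev f a)
    (a : ℕ → A) : ev (d n (idemHomotopy e f)) a = ev f a - ev f (fun k => e * a k) := by
  have hz : ∀ b, b 0 * ev f (shift 1 b)
      + (∑ i ∈ Finset.range (n + 1), (-1 : K) ^ (i + 1) • ev f (splice i 2 (mu (shift i b)) b))
      + (-1 : K) ^ n • (ev f b * b (n + 1)) = 0 := by
    intro b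
    have h := congrFun (mem_cocycles_iff.1 hf) b
    rw [ev_d] at h
    simp only [Pi.add_apply, Finset.sum_apply, Pi.smul_apply, rl, rc, rr, Pi.zero_apply] at h
    rwa [show (-1 : K) ^ (n + 1 + 1) = (-1 : K) ^ n by ring] at h
  -- The cocycle identity is evaluated at each of the `n + 2` sequences with `e` inserted and summed
  -- with alternating signs. Its left, inner and right faces are then computed separately in `q1`,
  -- `q2` and `q3`.
  have hs : ∑ j ∈ Finset.range (n + 2), (-1 : K) ^ j • (insertIdem e j a 0
        * ev f (shift 1 (insertIdem e j a))
      + (∑ i ∈ Finset.range (n + 1), (-1 : K) ^ (i + 1) •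
          ev f (splice i 2 (mu (shift i (insertIdem e j a))) (insertIdem e j a)))
      + (-1 : K) ^ n • (ev f (insertIdem e j a) * insertIdem e j a (n + 1))) = 0 :=
    Finset.sum_eq_zero fun j _ => by rw [hz, smul_zero]
  simp only [smul_add, Finset.sum_add_distrib] at hs
  have q1 : ∑ j ∈ Finset.range (n + 2), (-1 : K) ^ j • (insertIdem e j a 0
        * ev f (shift 1 (insertIdem e j a)))
      = ev f a - a 0 * ev (idemHomotopy e f) (shift 1 a) := by
    rw [Finset.sum_range_succ', ev_idemHomotopy, Finset.mul_sum, sub_eq_add_neg, add_comm,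
      ← Finset.sum_neg_distrib]
    -- The summand `j = 0` is `e f(a) = f(a)`. The others begin with `e a₀ = a₀ e`, whose `e` is
    -- absorbed by the values of `f`.
    congr 1
    · rw [shift_insertIdem_zero]; simp [insertIdem, hef]
    · refine Finset.sum_congr rfl fun j _ => ?_
      rw [shift_insertIdem_succ]
      have : insertIdem e (j + 1) a 0 = a 0 * e := by simp [insertIdem, hc]
      rw [this, mul_assoc, hef, pow_succ, mul_smul_comm]
      module
  have q2 : ∑ j ∈ Finset.range (n + 2), (-1 : K) ^ j • (∑ i ∈ Finset.range (n + 1),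
        (-1 : K) ^ (i + 1) •
          ev f (splice i 2 (mu (shift i (insertIdem e j a))) (insertIdem e j a)))
      = - ∑ i ∈ Finset.range n, (-1 : K) ^ (i + 1) •
          ev (idemHomotopy e f) (splice i 2 (mu (shift i a)) a) := by
    have h := sum_inner_faces (K := K) n
      (fun i j => ev f (splice i 2 (mu (shift i (insertIdem e j a))) (insertIdem e j a)))
      (fun i j => ev f (insertIdem e j (splice i 2 (mu (shift i a)) a)))
      (fun j => ev f (scaleInit e j a))
      (fun i j h => by rw [splice_insertIdem_before he hc h])
      (fun j => by rw [splice_insertIdem_left he hc])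
      (fun j => by rw [splice_insertIdem_right])
      (fun i j h => by rw [splice_insertIdem_after e h])
    simp only [ev_idemHomotopy, Finset.smul_sum, smul_smul, ← pow_add]
    rw [Finset.sum_comm (s := Finset.range n), ← neg_eq_iff_eq_neg, ← Finset.sum_neg_distrib]
    simp only [← Finset.sum_neg_distrib]
    have e1 : ∀ i j : ℕ, (-1 : K) ^ (j + (i + 1)) = - (-1 : K) ^ (i + j) := by intro i j; ring
    have e2 : ∀ i j : ℕ, (-1 : K) ^ (i + 1 + j) = (-1 : K) ^ (i + j + 1) := by intro i j; ring
    simp only [e1, neg_smul, neg_neg]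
    simp only [e2]
    exact h
  have q3 : ∑ j ∈ Finset.range (n + 2),
        (-1 : K) ^ j • (-1 : K) ^ n • (ev f (insertIdem e j a) * insertIdem e j a (n + 1))
      = (-1 : K) ^ n • (ev (idemHomotopy e f) a * a n) - ev f (fun k => e * a k) := by
    rw [Finset.sum_range_succ, ev_idemHomotopy, Finset.sum_mul, Finset.smul_sum, sub_eq_add_neg]
    congr 1
    · refine Finset.sum_congr rfl fun j hj => ?_
      have hj := Finset.mem_range.1 hj
      have : insertIdem e j a (n + 1) = a n := by
        simp only [insertIdem]; rw [if_neg (by omega), if_neg (by omega)]; rfl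
      rw [this, smul_mul_assoc, smul_comm]
    -- The summand `j = n + 1` evaluates `f` at the fully scaled tuple and multiplies by `e` on the
    -- right; `e` is central and fixes the values of `f`.
    · have h1 : insertIdem e (n + 1) a (n + 1) = e := by simp [insertIdem]
      have h2 : ev f (insertIdem e (n + 1) a) = ev f (fun k => e * a k) :=
        ev_congr f fun k hk => by simp [insertIdem, hk]
      rw [h1, h2, ← hc, hef, smul_smul, pow_succ, mul_right_comm, sign_sq]
      module
  rw [q1, q2, q3] at hs
  rw [ev_d]
  simp only [Pi.add_apply, Finset.sum_apply, Pi.smul_apply, rl, rc, rr]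
  rw [pow_succ, mul_neg_one, neg_smul]
  linear_combination (norm := module) -hs

/-! ### Maps in cohomology -/

lemma map_mem_cocycles (φ : ∀ n, Cochain K A n →ₗ[K] Cochain K B n)
    (h : ∀ n f, d n (φ n f) = φ (n + 1) (d n f)) {n : ℕ} (f : cocycles K A n) :
    φ n f.1 ∈ cocycles K B n := by
  rw [cocycles, LinearMap.mem_ker, h, d_eq_zero f.2, map_zero]

/-- The map in cohomology induced by a morphism of Hochschild complexes. -/
def HH.map (φ : ∀ n, Cochain K A n →ₗ[K] Cochain K B n)
    (h : ∀ n f, d n (φ n f) = φ (n + 1) (d n f)) (n : ℕ) : HH K A n →ₗ[K] HH K B n :=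
  Submodule.mapQ _ _ ((φ n).restrict (p := cocycles K A n) (q := cocycles K B n) fun f hf =>
      map_mem_cocycles φ h ⟨f, hf⟩) fun f hf => by
    change φ n f.1 ∈ coboundaries K B n
    change f.1 ∈ coboundaries K A n at hf
    cases n with
    | zero =>
      have : f.1 = 0 := hf
      rw [this, map_zero]; exact zero_mem _
    | succ k =>
      obtain ⟨g, hg⟩ := hf
      exact ⟨φ k g, by rw [h, hg]⟩

lemma HH.map_mk (φ : ∀ n, Cochain K A n →ₗ[K] Cochain K B n)
    (h : ∀ n f, d n (φ n f) = φ (n + 1) (d n f)) {n : ℕ} (f : cocycles K A n) :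
    HH.map φ h n (HH.mk n f) = HH.mk n ⟨φ n f.1, map_mem_cocycles φ h f⟩ := rfl

lemma HH.mk_congr {n : ℕ} {f g : cocycles K A n} (h : ev f.1 = ev g.1) :
    HH.mk n f = HH.mk n g := by
  rw [Subtype.ext (ev_injective h)]

/-! ### Direct factors of an algebra -/

variable (K A B)

/-- `B` as a direct factor of the algebra `A`: the projection `A → B` with its multiplicative
section, which identifies `B` with the ideal of `A` generated by a central idempotent. -/
structure Factor where
  /-- The projection onto the factor. -/
  proj : A →ₐ[K] B
  /-- The inclusion of the factor; it need not preserve the unit. -/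
  incl : B →ₗ[K] A
  incl_mul : ∀ x y, incl (x * y) = incl x * incl y
  proj_incl : ∀ x, proj (incl x) = x
  incl_proj : ∀ a, incl (proj a) = incl 1 * a
  idem_comm : ∀ a, incl 1 * a = a * incl 1

variable {K A B}

namespace Factor

variable (P : Factor K A B)

lemma idem_mul_self : P.incl 1 * P.incl 1 = P.incl 1 := by
  rw [← P.incl_mul, one_mul]

lemma idem_mul_incl (x : B) : P.incl 1 * P.incl x = P.incl x := by
  rw [← P.incl_mul, one_mul]

/-- The image of the factor is an ideal on which `A` acts through the projection, because `e` fixes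
`incl x` and may be moved onto `a`. With its right-handed version this handles the outer faces in
`d_push`. -/
lemma mul_incl (a : A) (x : B) : a * P.incl x = P.incl (P.proj a * x) := by
  rw [P.incl_mul, P.incl_proj, P.idem_comm, mul_assoc, P.idem_mul_incl]

lemma incl_mul_right (a : A) (x : B) : P.incl x * a = P.incl (x * P.proj a) := by
  rw [P.incl_mul, P.incl_proj, ← mul_assoc, ← P.incl_mul, mul_one]

/-- Restriction of cochains to the factor: `(b₁, …, b_n) ↦ proj (f(incl b₁, …, incl b_n))`. -/
def pull (n : ℕ) : Cochain K A n →ₗ[K] Cochain K B n where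
  toFun f := P.proj.toLinearMap.compMultilinearMap (f.compLinearMap fun _ => P.incl)
  map_add' f g := by ext; simp
  map_smul' c f := by ext; simp

/-- Extension of cochains from the factor: `(a₁, …, a_n) ↦ incl (g(proj a₁, …, proj a_n))`. -/
def push (n : ℕ) : Cochain K B n →ₗ[K] Cochain K A n where
  toFun g := P.incl.compMultilinearMap (g.compLinearMap fun _ => P.proj.toLinearMap)
  map_add' f g := by ext; simp
  map_smul' c f := by ext; simp

/-- Multiplication of the values of a cochain by the idempotent of the factor. -/
def scale (n : ℕ) : Cochain K A n →ₗ[K] Cochain K A n where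
  toFun f := (LinearMap.mulLeft K (P.incl 1)).compMultilinearMap f
  map_add' f g := by ext; simp
  map_smul' c f := by ext; simp

lemma ev_pull {n : ℕ} (f : Cochain K A n) (b : ℕ → B) :
    ev (P.pull n f) b = P.proj (ev f (P.incl ∘ b)) := rfl

lemma ev_push {n : ℕ} (g : Cochain K B n) (a : ℕ → A) :
    ev (P.push n g) a = P.incl (ev g (P.proj ∘ a)) := rfl

lemma ev_scale {n : ℕ} (f : Cochain K A n) (a : ℕ → A) :
    ev (P.scale n f) a = P.incl 1 * ev f a := rfl

/-! ### Compatibility with the Hochschild differential -/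

lemma comp_splice {C D : Type*} (u : C → D) (i n : ℕ) (y : C) (a : ℕ → C) :
    u ∘ splice i n y a = splice i n (u y) (u ∘ a) := by
  ext k; simp only [Function.comp, splice]; split_ifs <;> rfl

lemma comp_shift {C D : Type*} (u : C → D) (i : ℕ) (a : ℕ → C) :
    u ∘ shift i a = shift i (u ∘ a) := rfl

/-- The inner faces need only that the inclusion is multiplicative, not that it preserves the unit;
the outer faces use that the projection is multiplicative and splits the inclusion. -/
lemma d_pull (n : ℕ) (f : Cochain K A n) : d n (P.pull n f) = P.pull (n + 1) (d n f) := by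
  apply ev_injective
  ext b
  have h : ∀ i, P.incl (mu (shift i b)) = mu (shift i (P.incl ∘ b)) := fun i => P.incl_mul _ _
  simp only [ev_pull, ev_d, Pi.add_apply, Finset.sum_apply, Pi.smul_apply, rl, rc, rr, map_add,
    map_sum, map_smul, map_mul, comp_splice, comp_shift, h, Function.comp_apply, P.proj_incl]

lemma d_push (n : ℕ) (g : Cochain K B n) : d n (P.push n g) = P.push (n + 1) (d n g) := by
  apply ev_injective
  ext a
  have h : ∀ i, P.proj (mu (shift i a)) = mu (shift i (P.proj ∘ a)) := fun i => map_mul P.proj _ _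
  simp only [ev_push, ev_d, Pi.add_apply, Finset.sum_apply, Pi.smul_apply, rl, rc, rr, map_add,
    map_sum, map_smul, comp_splice, comp_shift, h, P.mul_incl, P.incl_mul_right,
    Function.comp_apply]

/-- Only the left outer face is affected by the position of the idempotent, which moves past `a₀` by
centrality. -/
lemma d_scale (n : ℕ) (f : Cochain K A n) : d n (P.scale n f) = P.scale (n + 1) (d n f) := by
  apply ev_injective
  ext a
  simp only [ev_scale, ev_d, Pi.add_apply, Finset.sum_apply, Pi.smul_apply, rl, rc, rr, mul_add,
    Finset.mul_sum, mul_smul_comm, mul_assoc]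
  rw [← mul_assoc (a 0), ← P.idem_comm, mul_assoc]

/-- Restriction to the factor in cohomology. -/
def pullHH : ∀ n, HH K A n →ₗ[K] HH K B n := HH.map P.pull P.d_pull

/-- Extension from the factor in cohomology. -/
def pushHH : ∀ n, HH K B n →ₗ[K] HH K A n := HH.map P.push P.d_push

/-- Multiplication by the idempotent of the factor in cohomology. -/
def scaleHH : ∀ n, HH K A n →ₗ[K] HH K A n := HH.map P.scale P.d_scale

/-! ### Composites of restriction and extension -/

lemma pullHH_pushHH {n : ℕ} (x : HH K B n) : P.pullHH n (P.pushHH n x) = x := by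
  obtain ⟨g, rfl⟩ := HH.mk_surjective _ x
  refine HH.mk_congr ?_
  ext b
  have : P.proj ∘ P.incl ∘ b = b := by ext k; exact P.proj_incl _
  change ev (P.pull n (P.push n g.1)) b = _
  rw [ev_pull, ev_push, P.proj_incl, this]

lemma pullHH_pushHH_of_orthogonal {C : Type*} [Ring C] [Algebra K C] (Q : Factor K A C)
    (h : ∀ x, P.proj (Q.incl x) = 0) {n : ℕ} (x : HH K C n) : P.pullHH n (Q.pushHH n x) = 0 := by
  obtain ⟨g, rfl⟩ := HH.mk_surjective _ x
  rw [← map_zero (HH.mk n)]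
  refine HH.mk_congr ?_
  ext b
  change ev (P.pull n (Q.push n g.1)) b = ev (0 : Cochain K B n) b
  rw [ev_pull, ev_push, h, map_zero, Pi.zero_apply]

/-- The homotopy applies to `e f`, a cocycle with values in `eA`: it bounds the difference of `e
f(a)` and `e f(e a)`, and the latter is restriction followed by extension. -/
lemma scale_sub_push_pull_mem {n : ℕ} (f : Cochain K A n) (hf : f ∈ cocycles K A n) :
    P.scale n f - P.push n (P.pull n f) ∈ coboundaries K A n := by
  have hpp : ∀ a, ev (P.push n (P.pull n f)) a = P.incl 1 * ev f (fun k => P.incl 1 * a k) := by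
    intro a
    have : P.incl ∘ P.proj ∘ a = fun k => P.incl 1 * a k := by ext k; exact P.incl_proj _
    rw [ev_push, ev_pull, P.incl_proj, this]
  cases n with
  | zero =>
    -- In degree `0` there are no arguments to scale, so the two cochains coincide, as they must
    -- since the coboundaries vanish.
    have : P.scale 0 f - P.push 0 (P.pull 0 f) = 0 := by
      apply ev_injective
      ext a
      rw [map_sub, Pi.sub_apply, hpp, ev_scale,
        ev_congr f (b := fun k => P.incl 1 * a k) (fun k hk => absurd hk (Nat.not_lt_zero k)),
        sub_self, map_zero, Pi.zero_apply]
    rw [this]; exact zero_mem _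
  | succ k =>
    refine mem_coboundaries_of_ev (idemHomotopy (P.incl 1) (P.scale (k + 1) f)) (Or.inl rfl) ?_
    ext a
    rw [ev_d_idemHomotopy P.idem_mul_self P.idem_comm _ (map_mem_cocycles P.scale P.d_scale ⟨f, hf⟩)
      (fun a => by rw [ev_scale, ← mul_assoc, P.idem_mul_self]), map_sub, Pi.sub_apply, hpp,
      ev_scale, ev_scale]

lemma pushHH_pullHH {n : ℕ} (x : HH K A n) : P.pushHH n (P.pullHH n x) = P.scaleHH n x := by
  obtain ⟨f, rfl⟩ := HH.mk_surjective _ x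
  exact (HH.mk_eq_mk.2 (P.scale_sub_push_pull_mem f.1 f.2)).symm

/-- Every class has a representative `f` whose component in the factor depends only on the
components of its arguments in the factor. -/
lemma exists_adapted {n : ℕ} (x : HH K A n) : ∃ f : cocycles K A n, HH.mk n f = x ∧
    ∀ a, P.proj (ev f.1 a) = P.proj (ev f.1 (P.incl ∘ P.proj ∘ a)) := by
  obtain ⟨f, rfl⟩ := HH.mk_surjective _ x
  have hs := map_mem_cocycles P.scale P.d_scale f
  have hp := map_mem_cocycles P.push P.d_push ⟨_, map_mem_cocycles P.pull P.d_pull f⟩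
  -- Subtracting this coboundary replaces the component of `f` in the factor by that of the
  -- extension of its restriction, and leaves the complementary component unchanged.
  refine ⟨f - (⟨_, hs⟩ - ⟨_, hp⟩), ?_, fun a => ?_⟩
  · rw [map_sub, sub_eq_self, HH.mk_eq_zero]
    exact P.scale_sub_push_pull_mem f.1 f.2
  · have h1 : P.proj (P.incl 1) = 1 := P.proj_incl 1
    have h2 : P.proj ∘ P.incl ∘ P.proj ∘ a = P.proj ∘ a := by ext k; exact P.proj_incl _
    change P.proj (ev (f.1 - (P.scale n f.1 - P.push n (P.pull n f.1))) a)
      = P.proj (ev (f.1 - (P.scale n f.1 - P.push n (P.pull n f.1))) _)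
    simp only [map_sub, Pi.sub_apply, ev_scale, ev_push, map_mul, h1, one_mul, P.proj_incl, h2,
      sub_sub_cancel]

/-! ### Restriction preserves the operations -/

lemma pull_preLie {m n : ℕ} (f : Cochain K A m)
    (hf : ∀ a, P.proj (ev f a) = P.proj (ev f (P.incl ∘ P.proj ∘ a))) (g : Cochain K A n) :
    ev (P.pull _ (preLie f g)) = ev (preLie (P.pull m f) (P.pull n g)) := by
  ext b
  have h : P.incl ∘ P.proj ∘ P.incl ∘ b = P.incl ∘ b := by
    ext k; exact congrArg P.incl (P.proj_incl _)
  rw [ev_pull, ev_preLie, ev_preLie]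
  simp only [Finset.sum_apply, Pi.smul_apply, map_sum, map_smul, rc]
  refine Finset.sum_congr rfl fun i _ => ?_
  -- The hypothesis on `f` replaces the inserted value of `g` by its component in the factor; the
  -- other entries already lie in the factor and do not change.
  rw [hf, ev_pull, ev_pull, comp_splice, comp_splice, comp_splice, h]
  rfl

lemma pullHH_cup {m n : ℕ} (x : HH K A m) (y : HH K A n) :
    P.pullHH _ (HH.cup m n x y) = HH.cup m n (P.pullHH m x) (P.pullHH n y) := by
  obtain ⟨f, rfl⟩ := HH.mk_surjective _ x
  obtain ⟨g, rfl⟩ := HH.mk_surjective _ y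
  refine HH.mk_congr ?_
  ext b
  change ev (P.pull _ (cup f.1 g.1)) b = ev (cup (P.pull m f.1) (P.pull n g.1)) b
  rw [ev_pull, ev_cup, ev_cup, map_mul]
  rfl

/-- The bracket contains both `f • g` and `g • f`, so both classes need adapted representatives;
`pull_preLie` asks this of the outer cochain only. -/
lemma pullHH_bracket {m n : ℕ} (x : HH K A m) (y : HH K A n) :
    P.pullHH _ (HH.bracket m n x y) = HH.bracket m n (P.pullHH m x) (P.pullHH n y) := by
  obtain ⟨f, rfl, hf⟩ := P.exists_adapted x
  obtain ⟨g, rfl, hg⟩ := P.exists_adapted y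
  refine HH.mk_congr ?_
  change ev (P.pull _ (bracketL m n f.1 g.1)) = ev (bracketL m n (P.pull m f.1) (P.pull n g.1))
  rw [ev_bracketL, ← P.pull_preLie f.1 hf, ← P.pull_preLie g.1 hg]
  ext b
  simp only [ev_pull, ev_bracketL, Pi.sub_apply, Pi.smul_apply, map_sub, map_smul]

lemma pullHH_sq {n : ℕ} (x : HH K A (2 * n)) :
    P.pullHH _ (HH.sq n x) = HH.sq n (P.pullHH _ x) := by
  obtain ⟨f, rfl, hf⟩ := P.exists_adapted x
  refine HH.mk_congr ?_
  change ev (P.pull _ (sqCochain n f.1)) = ev (sqCochain n (P.pull _ f.1))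
  rw [sqCochain, sqCochain, ev_castDeg, ← P.pull_preLie f.1 hf]
  ext b
  rw [ev_pull, ev_pull, ev_castDeg]

lemma pullHH_scalar (r : K) : P.pullHH 0 (HH.scalar r) = HH.scalar r := by
  refine HH.mk_congr ?_
  ext b
  exact P.proj.commutes r

/-- Restriction to the factor, as a homomorphism of Hochschild cohomology algebras. -/
def pullAlgHom : HHStar K A →ₐ[K] HHStar K B :=
  DirectSum.toAlgebra K (HH K A)
    (fun n => DirectSum.lof K ℕ (HH K B) n ∘ₗ P.pullHH n)
    (congrArg (DirectSum.lof K ℕ (HH K B) 0) (P.pullHH_scalar 1))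
    (fun x y => by
      refine (congrArg (DirectSum.lof K ℕ (HH K B) _) (P.pullHH_cup x y)).trans ?_
      exact (HHStar.lof_mul_lof _ _ _ _).symm)

lemma pullAlgHom_lof (n : ℕ) (x : HH K A n) :
    P.pullAlgHom (DirectSum.lof K ℕ (HH K A) n x)
      = DirectSum.lof K ℕ (HH K B) n (P.pullHH n x) :=
  DirectSum.toModule_lof K (M := HH K A)
    (φ := fun n => DirectSum.lof K ℕ (HH K B) n ∘ₗ P.pullHH n) n x

lemma pullAlgHom_apply (x : HHStar K A) (n : ℕ) : P.pullAlgHom x n = P.pullHH n (x n) := by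
  have : P.pullAlgHom.toLinearMap = DirectSum.lmap P.pullHH :=
    DirectSum.linearMap_ext K fun n => LinearMap.ext fun x => by
      simpa using P.pullAlgHom_lof n x
  exact congrArg (fun φ => φ x n) this

lemma pullAlgHom_bracket (x y : HHStar K A) :
    P.pullAlgHom (HHStar.bracket x y)
      = HHStar.bracket (P.pullAlgHom x) (P.pullAlgHom y) := by
  have : (HHStar.bracket (K := K) (A := A)).compr₂ P.pullAlgHom.toLinearMap
      = HHStar.bracket.compl₁₂ P.pullAlgHom.toLinearMap P.pullAlgHom.toLinearMap := by
    -- Both sides are bilinear, so it suffices to compare them on homogeneous elements.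
    refine DirectSum.linearMap_ext K fun m => LinearMap.ext fun x =>
      DirectSum.linearMap_ext K fun n => LinearMap.ext fun y => ?_
    simp only [LinearMap.comp_apply, LinearMap.compr₂_apply, LinearMap.compl₁₂_apply,
      AlgHom.toLinearMap_apply, HHStar.bracket_lof, pullAlgHom_lof, pullHH_bracket]
  exact congrArg (fun φ => φ x y) this

/-- Squaring is not additive in general, so linearity is of no help here; instead, it sees only the
component of degree `2n`, and restriction acts degree by degree. -/
lemma pullAlgHom_sq (n : ℕ) (x : HHStar K A) :
    P.pullAlgHom (HHStar.sq n x) = HHStar.sq n (P.pullAlgHom x) := by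
  rw [HHStar.sq, HHStar.sq, pullAlgHom_lof, pullHH_sq, pullAlgHom_apply]

/-- Extension from the factor on the Hochschild cohomology algebra. -/
def pushStar : HHStar K B →ₗ[K] HHStar K A := DirectSum.lmap P.pushHH

lemma pullAlgHom_pushStar (x : HHStar K B) : P.pullAlgHom (P.pushStar x) = x := by
  refine DFinsupp.ext fun n => ?_
  exact (P.pullAlgHom_apply _ n).trans (P.pullHH_pushHH (x n))

lemma pullAlgHom_pushStar_of_orthogonal {C : Type*} [Ring C] [Algebra K C] (Q : Factor K A C)
    (h : ∀ x, P.proj (Q.incl x) = 0) (x : HHStar K C) : P.pullAlgHom (Q.pushStar x) = 0 := by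
  refine DFinsupp.ext fun n => ?_
  exact (P.pullAlgHom_apply _ n).trans (P.pullHH_pushHH_of_orthogonal Q h (x n))

end Factor

lemma HHStar.mem_degree_iff {n : ℕ} {x : HHStar K A} :
    x ∈ HHStar.degree n ↔ ∀ k, k ≠ n → x k = 0 := by
  constructor
  · rintro ⟨y, rfl⟩ k hk
    exact DFinsupp.single_eq_of_ne hk
  · intro h
    refine ⟨x n, DFinsupp.ext fun k => ?_⟩
    rcases eq_or_ne k n with rfl | hk
    · exact DirectSum.lof_apply K k (x k)
    · rw [h k hk]; exact DFinsupp.single_eq_of_ne hk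

/-! ### Products -/

section Prod

variable (K) (R S : Type*) [Ring R] [Algebra K R] [Ring S] [Algebra K S]

/-- The first factor of `R × S`. -/
def Factor.fst : Factor K (R × S) R where
  proj := AlgHom.fst K R S
  incl := LinearMap.inl K R S
  incl_mul x y := by simp
  proj_incl x := rfl
  incl_proj a := by ext <;> simp
  idem_comm a := by ext <;> simp

/-- The second factor of `R × S`. -/
def Factor.snd : Factor K (R × S) S where
  proj := AlgHom.snd K R S
  incl := LinearMap.inr K R S
  incl_mul x y := by simp
  proj_incl x := rfl
  incl_proj a := by ext <;> simp
  idem_comm a := by ext <;> simp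

variable {K R S}

/-- The two idempotents add up to `1`, already on the values of cochains. -/
lemma scaleHH_fst_add_snd {n : ℕ} (x : HH K (R × S) n) :
    (Factor.fst K R S).scaleHH n x + (Factor.snd K R S).scaleHH n x = x := by
  obtain ⟨f, rfl⟩ := HH.mk_surjective _ x
  rw [Factor.scaleHH, Factor.scaleHH, HH.map_mk, HH.map_mk, ← map_add]
  refine HH.mk_congr ?_
  ext1 a
  change ev ((Factor.fst K R S).scale n f.1 + (Factor.snd K R S).scale n f.1) a = _
  rw [map_add, Pi.add_apply, Factor.ev_scale, Factor.ev_scale, ← add_mul]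
  have : (Factor.fst K R S).incl 1 + (Factor.snd K R S).incl 1 = 1 := by
    ext <;> simp [Factor.fst, Factor.snd]
  rw [this, one_mul]

variable (K R S)

/-- Restriction to both factors of `R × S`. -/
def prodAlgHom : HHStar K (R × S) →ₐ[K] HHStar K R × HHStar K S :=
  (Factor.fst K R S).pullAlgHom.prod (Factor.snd K R S).pullAlgHom

variable {K R S}

/-- The class is the sum of the extensions of its two restrictions. This gives injectivity, and also
the detection of degrees by the factors. -/
lemma eq_zero_of_pullHH_prod {n : ℕ} {x : HH K (R × S) n}
    (h1 : (Factor.fst K R S).pullHH n x = 0) (h2 : (Factor.snd K R S).pullHH n x = 0) :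
    x = 0 := by
  rw [← scaleHH_fst_add_snd x, ← Factor.pushHH_pullHH, ← Factor.pushHH_pullHH, h1, h2, map_zero,
    map_zero, add_zero]

lemma prodAlgHom_bijective : Function.Bijective (prodAlgHom K R S) := by
  constructor
  · rw [injective_iff_map_eq_zero]
    intro x hx
    refine DFinsupp.ext fun n => eq_zero_of_pullHH_prod ?_ ?_
    · rw [← Factor.pullAlgHom_apply]
      exact congrArg (fun z : HHStar K R × HHStar K S => z.1 n) hx
    · rw [← Factor.pullAlgHom_apply]
      exact congrArg (fun z : HHStar K R × HHStar K S => z.2 n) hx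
  · rintro ⟨y, z⟩
    -- Restricting this sum to one factor returns the matching component and kills the other by
    -- orthogonality.
    refine ⟨(Factor.fst K R S).pushStar y + (Factor.snd K R S).pushStar z, ?_⟩
    refine Prod.ext ?_ ?_
    · change (Factor.fst K R S).pullAlgHom _ = y
      rw [map_add, Factor.pullAlgHom_pushStar,
        Factor.pullAlgHom_pushStar_of_orthogonal _ _ (fun _ => rfl), add_zero]
    · change (Factor.snd K R S).pullAlgHom _ = z
      rw [map_add, Factor.pullAlgHom_pushStar,
        Factor.pullAlgHom_pushStar_of_orthogonal _ _ (fun _ => rfl), zero_add]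

lemma mem_degree_prod_iff {n : ℕ} {x : HHStar K (R × S)} : x ∈ HHStar.degree n ↔
    (Factor.fst K R S).pullAlgHom x ∈ HHStar.degree n ∧
      (Factor.snd K R S).pullAlgHom x ∈ HHStar.degree n := by
  simp only [HHStar.mem_degree_iff, Factor.pullAlgHom_apply]
  refine ⟨fun h => ⟨fun k hk => by rw [h k hk, map_zero], fun k hk => by rw [h k hk, map_zero]⟩,
    fun h k hk => eq_zero_of_pullHH_prod (h.1 k hk) (h.2 k hk)⟩

end Prod

/-! ### Finite products -/

section Pi

variable (K) {ι : Type*} (A : ι → Type*) [∀ i, Ring (A i)] [∀ i, Algebra K (A i)]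

open Classical in
/-- The factor with index `i` of `∏ A`. -/
def Factor.pi (i : ι) : Factor K (∀ i, A i) (A i) where
  proj := Pi.evalAlgHom K A i
  incl := LinearMap.single K A i
  incl_mul x y := Pi.single_mul i x y
  proj_incl x := Pi.single_eq_same i x
  incl_proj a := by
    ext j
    rcases eq_or_ne j i with rfl | h
    · simp
    · simp [h]
  idem_comm a := by
    ext j
    rcases eq_or_ne j i with rfl | h
    · simp
    · simp [h]

variable {K A}

/-- Finiteness of the index set enters here: the coordinate idempotents have a sum, and it is `1`.
-/
lemma sum_scaleHH_pi [Fintype ι] {n : ℕ} (x : HH K (∀ i, A i) n) :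
    ∑ i, (Factor.pi K A i).scaleHH n x = x := by
  classical
  obtain ⟨f, rfl⟩ := HH.mk_surjective _ x
  simp only [Factor.scaleHH, HH.map_mk]
  rw [← map_sum]
  refine HH.mk_congr ?_
  ext1 a
  rw [AddSubmonoidClass.coe_finsetSum, map_sum, Finset.sum_apply]
  simp only [Factor.ev_scale]
  have : ∑ i, (Factor.pi K A i).incl 1 = 1 := by
    simp only [Factor.pi, LinearMap.coe_single]
    convert Finset.univ_sum_single (1 : ∀ i, A i)
    rfl
  rw [← Finset.sum_mul, this, one_mul]

variable (K A)

/-- Restriction to all factors of `∏ A`. -/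
def piAlgHom : HHStar K (∀ i, A i) →ₐ[K] ∀ i, HHStar K (A i) :=
  AlgHom.pi fun i => (Factor.pi K A i).pullAlgHom

variable {K A}

lemma eq_zero_of_pullHH_pi [Finite ι] {n : ℕ} {x : HH K (∀ i, A i) n}
    (h : ∀ i, (Factor.pi K A i).pullHH n x = 0) : x = 0 := by
  have := Fintype.ofFinite ι
  rw [← sum_scaleHH_pi x]
  exact Finset.sum_eq_zero fun i _ => by rw [← Factor.pushHH_pullHH, h, map_zero]

lemma piAlgHom_bijective [Finite ι] : Function.Bijective (piAlgHom K A) := by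
  have := Fintype.ofFinite ι
  constructor
  · rw [injective_iff_map_eq_zero]
    intro x hx
    refine DFinsupp.ext fun n => eq_zero_of_pullHH_pi fun i => ?_
    rw [← Factor.pullAlgHom_apply]
    exact congrArg (fun z : ∀ i, HHStar K (A i) => z i n) hx
  · intro y
    -- Under restriction to the factor `i`, orthogonality leaves only the summand with index `i`.
    refine ⟨∑ i, (Factor.pi K A i).pushStar (y i), funext fun i => ?_⟩
    change (Factor.pi K A i).pullAlgHom _ = y i
    rw [map_sum, Finset.sum_eq_single i, Factor.pullAlgHom_pushStar]
    · intro j _ hj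
      exact Factor.pullAlgHom_pushStar_of_orthogonal _ _
        (fun x => by simp [Factor.pi, hj.symm]) _
    · intro h; exact absurd (Finset.mem_univ i) h

lemma mem_degree_pi_iff [Finite ι] {n : ℕ} {x : HHStar K (∀ i, A i)} : x ∈ HHStar.degree n ↔
    ∀ i, (Factor.pi K A i).pullAlgHom x ∈ HHStar.degree n := by
  simp only [HHStar.mem_degree_iff, Factor.pullAlgHom_apply]
  exact ⟨fun h i k hk => by rw [h k hk, map_zero],
    fun h k hk => eq_zero_of_pullHH_pi fun i => h i k hk⟩

end Pi

end

end Hochschild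

/-- Hochschild cohomology, as a strict Gerstenhaber algebra (graded algebra under the cup product,
Gerstenhaber bracket, squaring map), commutes with binary and with finite products. The product of
strict Gerstenhaber algebras has componentwise grading and componentwise operations. -/
theorem mainTheorem8 {K : Type*} [CommRing K]
    {R S : Type*} [Ring R] [Algebra K R] [Module.Projective K R]
    [Ring S] [Algebra K S] [Module.Projective K S]
    {ι : Type*} [Finite ι] {A : ι → Type*} [∀ i, Ring (A i)] [∀ i, Algebra K (A i)]
    [∀ i, Module.Projective K (A i)] :
    (∃ Φ : Hochschild.HHStar K (R × S) ≃ₐ[K] Hochschild.HHStar K R × Hochschild.HHStar K S,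
      (∀ (n : ℕ) (x : Hochschild.HHStar K (R × S)), x ∈ Hochschild.HHStar.degree n ↔
        (Φ x).1 ∈ Hochschild.HHStar.degree n ∧ (Φ x).2 ∈ Hochschild.HHStar.degree n) ∧
      (∀ x y : Hochschild.HHStar K (R × S), Φ (Hochschild.HHStar.bracket x y) =
        (Hochschild.HHStar.bracket (Φ x).1 (Φ y).1, Hochschild.HHStar.bracket (Φ x).2 (Φ y).2)) ∧
      (∀ (n : ℕ), ∀ x ∈ Hochschild.HHStar.degree (K := K) (A := R × S) (2 * n),
        Φ (Hochschild.HHStar.sq n x) =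
          (Hochschild.HHStar.sq n (Φ x).1, Hochschild.HHStar.sq n (Φ x).2))) ∧
    (∃ Φ : Hochschild.HHStar K (∀ i, A i) ≃ₐ[K] (∀ i, Hochschild.HHStar K (A i)),
      (∀ (n : ℕ) (x : Hochschild.HHStar K (∀ i, A i)), x ∈ Hochschild.HHStar.degree n ↔
        ∀ i, Φ x i ∈ Hochschild.HHStar.degree n) ∧
      (∀ x y : Hochschild.HHStar K (∀ i, A i), Φ (Hochschild.HHStar.bracket x y) =
        fun i => Hochschild.HHStar.bracket (Φ x i) (Φ y i)) ∧
      (∀ (n : ℕ), ∀ x ∈ Hochschild.HHStar.degree (K := K) (A := ∀ i, A i) (2 * n),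
        Φ (Hochschild.HHStar.sq n x) = fun i => Hochschild.HHStar.sq n (Φ x i))) := by
  refine ⟨⟨AlgEquiv.ofBijective (Hochschild.prodAlgHom K R S) Hochschild.prodAlgHom_bijective,
    fun n x => Hochschild.mem_degree_prod_iff, fun x y => ?_, fun n x _ => ?_⟩,
    ⟨AlgEquiv.ofBijective (Hochschild.piAlgHom K A) Hochschild.piAlgHom_bijective,
    fun n x => Hochschild.mem_degree_pi_iff, fun x y => ?_, fun n x _ => ?_⟩⟩
  · exact Prod.ext (Hochschild.Factor.pullAlgHom_bracket _ x y)
      (Hochschild.Factor.pullAlgHom_bracket _ x y)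
  · exact Prod.ext (Hochschild.Factor.pullAlgHom_sq _ n x)
      (Hochschild.Factor.pullAlgHom_sq _ n x)
  · exact funext fun i => Hochschild.Factor.pullAlgHom_bracket _ x y
  · exact funext fun i => Hochschild.Factor.pullAlgHom_sq _ n x
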